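/- **Theorem 3.2 (Distributional extension).** Let $\mathbb H,\mathbb V,\mathbb M_1,\mathbb M_2$ be real Hilbert spaces, with $\mathbb V$ continuously embedded in $\mathbb H$, and let $\mathbb M=\mathbb M_1\times\mathbb M_2$ have the product Hilbert norm. Let $\mathsf A_\star:\mathbb V\to\mathbb H$, $\mathsf B:\mathbb V\to\mathbb M_2$ and $\mathsf G:\mathbb M_1\to\mathbb H$ be bounded linear operators, with $\mathsf B$ surjective. Assume: 1. there is $C_1>0$ with $C_1\|U\|_{\mathbb V}\le\|U\|_{\mathbb H}+\|\mathsf A_\star U\|_{\mathbb H}$ for all $U\in\mathbb V$; 2. $(\mathsf A_\star U,U)_{\mathbb H}=0$ for all $U\in\operatorname{Ker}\mathsf B$, and for both signs $\{U\pm\mathsf A_\star U: U\in\operatorname{Ker}\mathsf B\}=\mathbb H$; 3. for every $(x,y)\in\mathbb M$ there is a unique $U\in\mathbb V$ with $U=\mathsf A_\star U+\mathsf Gx$ and $\mathsf BU=y$, and it satisfies $\|U\|_{\mathbb H}+\|U\|_{\mathbb V}\le C_{\rm lift}\|(x,y)\|_{\mathbb M}$ with $C_{\rm lift}$ independent of $(x,y)$.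 For a Hilbert space $X$ and $k\ge1$, let $W^k(X)$ be the set of $f\in\mathcal C^{k-1}([0,\infty);X)$ with $f^{(k)}\in L^1((0,\infty);X)$ (distributional derivative) and $f^{(\ell)}(0)=0$ for $0\le\ell\le k-1$. For $f$ defined on $[0,\infty)$, let $Ef$ be its extension by zero to $\mathbb R$; a locally integrable function on $\mathbb R$ is identified with the distribution it defines. Let $\mathrm{TD}(X)$ be the set of $X$-valued distributions on $\mathbb R$ of the form $g^{(k)}$, where $k\ge0$ is an integer and $g:\mathbb R\to X$ is continuous with $g(t)=0$ for $t\le0$ and $\|g(t)\|\le Ct^m$ for $t\ge1$, for some $C$ and $m\ge0$. Let $F\in W^1(\mathbb H)$ and $(\xi,\chi)\in W^2(\mathbb M)$. Then there is a unique $U\in\mathcal C^1([0,\infty);\mathbb H)\cap\mathcal C([0,\infty);\mathbb V)$ with $$\dot U(t)=\mathsf A_\star U(t)+\mathsf G\xi(t)+F(t),\qquad \mathsf BU(t)=\chi(t)\qquad(t\ge0),\qquad U(0)=0,$$ and its extension by zero $EU$ is the unique solution of $$\underline U\in\mathrm{TD}(\mathbb V),\qquad \dot{\underline U}=\mathsf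 A_\star\underline U+\mathsf G\,E\xi+EF,\qquad \mathsf B\,\underline U=E\chi,$$ where the second relation is an equality of $\mathbb H$-valued distributions on $\mathbb R$ and the third one of $\mathbb M_2$-valued distributions on $\mathbb R$. -/

import Mathlib

open Set MeasureTheory
open scoped Distributions LineDeriv

noncomputable section

namespace DistExt

/-- Extension by zero `E f` to the whole line of a function `f` on `[0, ∞)`
(only the values of `f` on `[0, ∞)` are used). -/
def extZero {X : Type*} [Zero X] (f : ℝ → X) (t : ℝ) : X :=
  if 0 ≤ t then f t else 0

section Distributions

variable {X : Type*} [NormedAddCommGroup X] [NormedSpace ℝ X]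

/-- The `X`-valued distribution `φ ↦ ∫ φ(t) f(t) dt` given by a locally integrable function
`f : ℝ → X`. -/
def regDist (f : ℝ → X) : 𝓓'((⊤ : TopologicalSpace.Opens ℝ), X) :=
  (TestFunction.integralAgainstBilinCLM (ContinuousLinearMap.lsmul ℝ ℝ) volume f :
    𝓓((⊤ : TopologicalSpace.Opens ℝ), ℝ) →L[ℝ] X)

/-- The derivative `Ṫ` of an `X`-valued distribution, `⟨Ṫ, φ⟩ = -⟨T, φ'⟩`. -/
def distDeriv (T : 𝓓'((⊤ : TopologicalSpace.Opens ℝ), X)) :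
    𝓓'((⊤ : TopologicalSpace.Opens ℝ), X) :=
  ∂_{(1 : ℝ)} T

/-- The class `TD(X)`: distributions `T = g^{(k)}` for some `k ≥ 0` and some continuous
`g : ℝ → X` which vanishes on `(-∞, 0]` and grows at most polynomially.
All of them are causal. -/
def IsTD (T : 𝓓'((⊤ : TopologicalSpace.Opens ℝ), X)) : Prop :=
  ∃ g : ℝ → X, Continuous g ∧ (∀ t ≤ 0, g t = 0) ∧
    (∃ C m : ℝ, 0 ≤ m ∧ ∀ t, 1 ≤ t → ‖g t‖ ≤ C * t ^ m) ∧
    ∃ k : ℕ, T = distDeriv^[k] (regDist g)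

/-- The space `W^k(X)`, `k ≥ 1`: functions of class `C^{k-1}` on `[0, ∞)` with
`f^{(ℓ)}(0) = 0` for `0 ≤ ℓ ≤ k - 1` and `f^{(k)} ∈ L¹((0, ∞); X)`. Since `f^{(k-1)}` is continuous
and vanishes at `0`, its distributional derivative on `(0, ∞)` is the integrable function `h`
exactly when `f^{(k-1)}(t) = ∫₀ᵗ h` for all `t ≥ 0`. -/
def MemW (k : ℕ) (f : ℝ → X) : Prop :=
  1 ≤ k ∧ ContDiffOn ℝ ((k - 1 : ℕ) : ℕ∞) f (Ici 0) ∧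
    (∀ l ≤ k - 1, iteratedDerivWithin l f (Ici 0) 0 = 0) ∧
    ∃ h : ℝ → X, IntegrableOn h (Ioi 0) ∧
      ∀ t, 0 ≤ t → iteratedDerivWithin (k - 1) f (Ici 0) t = ∫ τ in (0 : ℝ)..t, h τ

end Distributions

section Problems

variable {H V M₁ M₂ : Type*}
  [NormedAddCommGroup H] [NormedSpace ℝ H] [NormedAddCommGroup V] [NormedSpace ℝ V]
  [NormedAddCommGroup M₁] [NormedSpace ℝ M₁] [NormedAddCommGroup M₂] [NormedSpace ℝ M₂]

/-- `U ∈ C¹([0, ∞); H) ∩ C([0, ∞); V)` solves, for `t ≥ 0`,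
`U̇(t) = A U(t) + G ξ(t) + F(t)`, `B U(t) = χ(t)`, with `U(0) = 0`.
Here `ι` is the embedding of `V` into `H`. -/
structure IsClassicalSolution (ι A : V →L[ℝ] H) (B : V →L[ℝ] M₂) (G : M₁ →L[ℝ] H)
    (ξ : ℝ → M₁) (χ : ℝ → M₂) (F : ℝ → H) (U : ℝ → V) : Prop where
  continuousOn : ContinuousOn U (Ici 0)
  contDiffOn : ContDiffOn ℝ 1 (fun t => ι (U t)) (Ici 0)
  hasDeriv : ∀ t, 0 ≤ t →
    HasDerivWithinAt (fun s => ι (U s)) (A (U t) + G (ξ t) + F t) (Ici 0) t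
  boundary : ∀ t, 0 ≤ t → B (U t) = χ t
  initial : U 0 = 0

/-- `T ∈ TD(V)` solves `Ṫ = A T + G ξ + F` (as `H`-valued distributions) and
`B T = χ` (as `M₂`-valued distributions). Here `ι` is the embedding of `V` into `H`. -/
structure IsDistSolution (ι A : V →L[ℝ] H) (B : V →L[ℝ] M₂) (G : M₁ →L[ℝ] H)
    (ξ : 𝓓'((⊤ : TopologicalSpace.Opens ℝ), M₁)) (χ : 𝓓'((⊤ : TopologicalSpace.Opens ℝ), M₂))
    (F : 𝓓'((⊤ : TopologicalSpace.Opens ℝ), H))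
    (T : 𝓓'((⊤ : TopologicalSpace.Opens ℝ), V)) : Prop where
  isTD : IsTD T
  equation : Distribution.mapCLM ι (distDeriv T) =
    Distribution.mapCLM A T + Distribution.mapCLM G ξ + F
  boundary : Distribution.mapCLM B T = χ

end Problems

end DistExt

end

/-! Existence. Let `Ξ = (ξ, χ)`, let `L` be the bounded lifting operator and `Q = ι ∘ L`. Setting `U
= L Ξ + Z` removes the boundary data: `Z` takes values in `Ker B`, starts from 0, and solves `(ι Z)'
= A Z + f` with `f = F + Q Ξ - Q Ξ'`. As `F ∈ W¹` and `Ξ ∈ W²`, `f` is the primitive of a locally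
integrable `h`, so the formal time derivative `w` of `ι Z` solves `w' = A w + h` in the mild sense.

No unbounded generator is manipulated: everything is phrased through `J = ι (1 - A)⁻¹`, the inverse
being taken on `Ker B`. Skew-symmetry of `A` there gives `(J x, x) = ‖J x‖²`, hence `J` has dense
range, and `1 - J⁻¹` is a limit of bounded, commuting, dissipative operators. Their exponentials
converge to a contraction semigroup (Hille-Yosida), and Duhamel's formula gives `w`. Integrating `w`
recovers `Z`. Tracking norms shows that `U` grows at most quadratically.

Passage to distributions. Since `U(0) = 0`, the zero extension creates no Dirac mass at 0, so `EU`
solves the distributional problem; the growth bound puts it in `TD(V)` as a derivative of order 0.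

Uniqueness. After integrating enough times, the difference of two solutions is `g^{(k)}` with `g`
continuous and causal. A causal distribution with zero derivative vanishes, so derivatives cancel
from the equations: `B g = 0` and `ι g = ∫ A g`. Thus `g` is a classical solution with zero data,
and conservation of `‖ι g‖²` forces `g = 0`. The same energy argument gives classical uniqueness. -/

namespace DistExt

/-! ### Vector-valued distributions on the line: derivatives, primitives, causality. -/

section Distributions

open Filter Topology

variable {X Y : Type*} [NormedAddCommGroup X] [NormedSpace ℝ X]
  [NormedAddCommGroup Y] [NormedSpace ℝ Y]

theorem regDist_apply {f : ℝ → X} (hf : LocallyIntegrable f)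
    (φ : 𝓓((⊤ : TopologicalSpace.Opens ℝ), ℝ)) : regDist f φ = ∫ t, φ t • f t :=
  TestFunction.integralAgainstBilinCLM_eq_integral (B := ContinuousLinearMap.lsmul ℝ ℝ)
    (hf.locallyIntegrableOn _)

theorem integrable_testFunction_smul {f : ℝ → X} (hf : LocallyIntegrable f)
    (φ : 𝓓((⊤ : TopologicalSpace.Opens ℝ), ℝ)) : Integrable fun t => φ t • f t :=
  hf.integrable_smul_left_of_hasCompactSupport φ.continuous φ.hasCompactSupport

theorem lineDeriv_testFunction_apply (φ : 𝓓((⊤ : TopologicalSpace.Opens ℝ), ℝ)) (t : ℝ) :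
    (∂_{(1 : ℝ)} φ : 𝓓((⊤ : TopologicalSpace.Opens ℝ), ℝ)) t = deriv φ t := by
  rw [TestFunction.lineDerivOp_eq_lineDerivCLM ℝ,
    TestFunction.lineDerivCLM_apply_of_le (by simp)]
  have h : DifferentiableAt ℝ φ t := (φ.contDiff.differentiable (by simp)).differentiableAt
  rw [h.lineDeriv_eq_fderiv, fderiv_apply_one_eq_deriv]

theorem distDeriv_apply (T : 𝓓'((⊤ : TopologicalSpace.Opens ℝ), X))
    (φ : 𝓓((⊤ : TopologicalSpace.Opens ℝ), ℝ)) :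
    distDeriv T φ = -T (∂_{(1 : ℝ)} φ) := rfl

theorem distDeriv_sub (S T : 𝓓'((⊤ : TopologicalSpace.Opens ℝ), X)) :
    distDeriv (S - T) = distDeriv S - distDeriv T :=
  map_sub (Distribution.lineDerivCLM (1 : ℝ)) S T

theorem distDeriv_iterate_sub (k : ℕ) (S T : 𝓓'((⊤ : TopologicalSpace.Opens ℝ), X)) :
    distDeriv^[k] (S - T) = distDeriv^[k] S - distDeriv^[k] T := by
  induction k with
  | zero => rfl
  | succ k ih => simp only [Function.iterate_succ_apply', ih, distDeriv_sub]

theorem mapCLM_distDeriv (L : X →L[ℝ] Y) (T : 𝓓'((⊤ : TopologicalSpace.Opens ℝ), X)) :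
    Distribution.mapCLM L (distDeriv T) = distDeriv (Distribution.mapCLM L T) := by
  ext φ
  simp [distDeriv_apply]

theorem mapCLM_distDeriv_iterate (L : X →L[ℝ] Y) (k : ℕ)
    (T : 𝓓'((⊤ : TopologicalSpace.Opens ℝ), X)) :
    Distribution.mapCLM L (distDeriv^[k] T) = distDeriv^[k] (Distribution.mapCLM L T) := by
  induction k with
  | zero => rfl
  | succ k ih => simp only [Function.iterate_succ_apply', ← ih, mapCLM_distDeriv]

theorem mapCLM_regDist [CompleteSpace X] [CompleteSpace Y] (L : X →L[ℝ] Y) {f : ℝ → X}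
    (hf : LocallyIntegrable f) :
    Distribution.mapCLM L (regDist f) = regDist fun t => L (f t) := by
  ext φ
  have hLf : LocallyIntegrable fun t => L (f t) := fun t => by
    obtain ⟨s, hs, h⟩ := hf t
    exact ⟨s, hs, L.integrable_comp h⟩
  rw [Distribution.mapCLM_apply, regDist_apply hf, regDist_apply hLf,
    ← L.integral_comp_comm (integrable_testFunction_smul hf φ)]
  simp

theorem regDist_sub {f g : ℝ → X} (hf : LocallyIntegrable f) (hg : LocallyIntegrable g) :
    regDist (fun t => f t - g t) = regDist f - regDist g := by
  ext φ
  have h : LocallyIntegrable fun t => f t - g t := hf.sub hg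
  rw [regDist_apply h]
  change _ = regDist f φ - regDist g φ
  rw [regDist_apply hf, regDist_apply hg,
    ← integral_sub (integrable_testFunction_smul hf φ) (integrable_testFunction_smul hg φ)]
  simp only [smul_sub]

theorem regDist_add {f g : ℝ → X} (hf : LocallyIntegrable f) (hg : LocallyIntegrable g) :
    regDist (fun t => f t + g t) = regDist f + regDist g := by
  ext φ
  have h : LocallyIntegrable fun t => f t + g t := hf.add hg
  rw [regDist_apply h]
  change _ = regDist f φ + regDist g φ
  rw [regDist_apply hf, regDist_apply hg,
    ← integral_add (integrable_testFunction_smul hf φ) (integrable_testFunction_smul hg φ)]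
  simp only [smul_add]

omit [NormedSpace ℝ X] in
theorem extZero_eq_indicator (f : ℝ → X) : extZero f = (Ici 0).indicator f := by
  ext t
  simp [extZero, indicator_apply]

omit [NormedSpace ℝ X] in
theorem extZero_of_nonneg (f : ℝ → X) {t : ℝ} (ht : 0 ≤ t) : extZero f t = f t := if_pos ht

omit [NormedSpace ℝ X] in
theorem continuous_comp_max {f : ℝ → X} (hf : ContinuousOn f (Ici 0)) :
    Continuous fun t => f (max t 0) :=
  hf.comp_continuous (by fun_prop) fun t => mem_Ici.2 (le_max_right t 0)

omit [NormedSpace ℝ X] in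
theorem locallyIntegrable_extZero {f : ℝ → X} (hf : ContinuousOn f (Ici 0)) :
    LocallyIntegrable (extZero f) := by
  have h : extZero f = (Ici 0).indicator fun t => f (max t 0) := by
    rw [extZero_eq_indicator]
    refine indicator_congr fun t ht => ?_
    rw [max_eq_left ht]
  rw [h]
  exact (continuous_comp_max hf).locallyIntegrable.indicator measurableSet_Ici

omit [NormedSpace ℝ X] in
theorem continuous_extZero {f : ℝ → X} (hf : ContinuousOn f (Ici 0)) (h0 : f 0 = 0) :
    Continuous (extZero f) := by
  have h : extZero f = fun t => f (max t 0) := by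
    ext t
    rcases le_or_gt 0 t with ht | ht
    · rw [extZero_of_nonneg f ht, max_eq_left ht]
    · rw [extZero, if_neg ht.not_ge, max_eq_right ht.le, h0]
  rw [h]
  exact continuous_comp_max hf

omit [NormedSpace ℝ X] in
theorem extZero_eq_self {f : ℝ → X} (h : ∀ t ≤ 0, f t = 0) : extZero f = f := by
  ext t
  rcases le_or_gt 0 t with ht | ht
  · exact extZero_of_nonneg f ht
  · rw [extZero, if_neg ht.not_ge, h t ht.le]

/-- Integration by parts on the half-line: `f 0 = 0` kills the boundary term, which would otherwise
be a Dirac mass at 0. -/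
theorem distDeriv_regDist_extZero [CompleteSpace X] {f f' : ℝ → X}
    (hf' : ContinuousOn f' (Ici 0))
    (hderiv : ∀ t, 0 ≤ t → HasDerivWithinAt f (f' t) (Ici 0) t) (h0 : f 0 = 0) :
    distDeriv (regDist (extZero f)) = regDist (extZero f') := by
  have hf : ContinuousOn f (Ici 0) := fun t ht => (hderiv t ht).continuousWithinAt
  have hi := locallyIntegrable_extZero hf
  have hi' := locallyIntegrable_extZero hf'
  ext φ
  set ψ : 𝓓((⊤ : TopologicalSpace.Opens ℝ), ℝ) := ∂_{(1 : ℝ)} φ with hψ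
  rw [distDeriv_apply, regDist_apply hi, regDist_apply hi', neg_eq_iff_add_eq_zero,
    ← integral_add (integrable_testFunction_smul hi _) (integrable_testFunction_smul hi' _)]
  have hint : Integrable fun t => ψ t • extZero f t + φ t • extZero f' t :=
    (integrable_testFunction_smul hi _).add (integrable_testFunction_smul hi' _)
  have heq : (fun t => ψ t • extZero f t + φ t • extZero f' t) =
      (Ici 0).indicator fun t => φ t • f' t + deriv φ t • f t := by
    ext t
    simp only [extZero_eq_indicator, indicator_apply]
    split_ifs
    · rw [hψ, lineDeriv_testFunction_apply, add_comm]
    · simp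
  rw [heq] at hint ⊢
  rw [integral_indicator measurableSet_Ici, integral_Ici_eq_integral_Ioi]
  rw [integrable_indicator_iff measurableSet_Ici] at hint
  have hφ : ∀ t, HasDerivAt φ (deriv φ t) t := fun t =>
    (φ.contDiff.differentiable (by simp)).differentiableAt.hasDerivAt
  rw [integral_Ioi_of_hasDerivAt_of_tendsto (f := fun t => φ t • f t) (m := 0)]
  · simp [h0]
  · exact φ.continuous.continuousWithinAt.smul (hf 0 self_mem_Ici)
  · intro t ht
    exact (hφ t).smul ((hderiv t (le_of_lt ht)).hasDerivAt (Ici_mem_nhds ht))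
  · exact hint.mono_set Ioi_subset_Ici_self
  · have hz : φ =ᶠ[atTop] 0 :=
      (hasCompactSupport_iff_eventuallyEq.1 φ.hasCompactSupport).filter_mono
        (by rw [coclosedCompact_eq_cocompact]; exact atTop_le_cocompact)
    refine tendsto_const_nhds.congr' ?_
    filter_upwards [hz] with t ht
    simp [ht]

theorem primitive_eq_zero {g : ℝ → X} (h0 : ∀ t ≤ 0, g t = 0) (t : ℝ) (ht : t ≤ 0) :
    ∫ s in (0 : ℝ)..t, g s = 0 := by
  rw [intervalIntegral.integral_symm, neg_eq_zero]
  refine (intervalIntegral.integral_congr fun s hs => ?_).trans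
    intervalIntegral.integral_zero
  rw [uIcc_of_le ht] at hs
  exact h0 s hs.2

/-- The primitive vanishing at `0` inverts the derivative of causal continuous functions. -/
theorem distDeriv_regDist_primitive [CompleteSpace X] {g : ℝ → X} (hg : Continuous g)
    (h0 : ∀ t ≤ 0, g t = 0) :
    distDeriv (regDist fun t => ∫ s in (0 : ℝ)..t, g s) = regDist g := by
  have := distDeriv_regDist_extZero (f := fun t => ∫ s in (0 : ℝ)..t, g s) (f' := g)
    hg.continuousOn (fun t _ => (hg.integral_hasStrictDerivAt 0 t).hasDerivAt.hasDerivWithinAt)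
    (by simp)
  rwa [extZero_eq_self (primitive_eq_zero h0), extZero_eq_self h0] at this

/-- Serves to write two elements of `TD` as derivatives of the same order. -/
theorem exists_primitive_iterate [CompleteSpace X] (k : ℕ) {g : ℝ → X} (hg : Continuous g)
    (h0 : ∀ t ≤ 0, g t = 0) :
    ∃ f : ℝ → X, Continuous f ∧ (∀ t ≤ 0, f t = 0) ∧ distDeriv^[k] (regDist f) = regDist g := by
  induction k with
  | zero => exact ⟨g, hg, h0, rfl⟩
  | succ k ih =>
    obtain ⟨f, hf, hf0, h⟩ := ih
    refine ⟨fun t => ∫ s in (0 : ℝ)..t, f s,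
      intervalIntegral.continuous_primitive (fun a b => hf.intervalIntegrable a b) 0,
      primitive_eq_zero hf0, ?_⟩
    rw [Function.iterate_succ_apply, distDeriv_regDist_primitive hf hf0, h]

/-- A distribution is causal if it vanishes on `(-∞, 0)`. -/
def IsCausal (T : 𝓓'((⊤ : TopologicalSpace.Opens ℝ), X)) : Prop :=
  ∀ φ : 𝓓((⊤ : TopologicalSpace.Opens ℝ), ℝ), tsupport φ ⊆ Iio 0 → T φ = 0

theorem IsCausal.distDeriv {T : 𝓓'((⊤ : TopologicalSpace.Opens ℝ), X)} (hT : IsCausal T) :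
    IsCausal (distDeriv T) := fun φ hφ => by
  rw [distDeriv_apply, hT, neg_zero]
  have h : ((∂_{(1 : ℝ)} φ : 𝓓((⊤ : TopologicalSpace.Opens ℝ), ℝ)) : ℝ → ℝ) = deriv φ :=
    funext (lineDeriv_testFunction_apply φ)
  rw [h]
  exact (closure_minimal support_deriv_subset (isClosed_tsupport _)).trans hφ

theorem IsCausal.distDeriv_iterate {T : 𝓓'((⊤ : TopologicalSpace.Opens ℝ), X)} (hT : IsCausal T)
    (k : ℕ) : IsCausal (DistExt.distDeriv^[k] T) := by
  induction k with
  | zero => exact hT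
  | succ k ih => rw [Function.iterate_succ_apply']; exact ih.distDeriv

theorem isCausal_regDist {f : ℝ → X} (hf : LocallyIntegrable f) (h0 : ∀ t < 0, f t = 0) :
    IsCausal (regDist f) := fun φ hφ => by
  rw [regDist_apply hf]
  refine (integral_congr_ae (Eventually.of_forall fun t => ?_)).trans (integral_zero ℝ X)
  rcases lt_or_ge t 0 with ht | ht
  · simp [h0 t ht]
  · have : t ∉ tsupport φ := fun h => not_lt.2 ht (hφ h)
    simp [image_eq_zero_of_notMem_tsupport this]

/-- The primitive started to the left of the support is constant to its right, equal to the total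
integral; hence it has compact support. -/
theorem exists_lineDeriv_eq_of_integral_eq_zero (φ : 𝓓((⊤ : TopologicalSpace.Opens ℝ), ℝ))
    (h : ∫ t, φ t = 0) :
    ∃ ψ : 𝓓((⊤ : TopologicalSpace.Opens ℝ), ℝ), ∂_{(1 : ℝ)} ψ = φ := by
  obtain ⟨R, hR⟩ := φ.hasCompactSupport.isBounded.subset_ball 0
  have hout : ∀ t, R ≤ |t| → φ t = 0 := fun t ht => by
    refine image_eq_zero_of_notMem_tsupport fun hmem => ?_
    have := hR hmem
    rw [mem_ball_zero_iff, Real.norm_eq_abs] at this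
    linarith
  set p : ℝ → ℝ := fun t => ∫ s in (-R)..t, φ s with hp
  have hderiv : ∀ t, HasDerivAt p (φ t) t := fun t =>
    (φ.continuous.integral_hasStrictDerivAt _ t).hasDerivAt
  have hd : deriv p = φ := funext fun t => (hderiv t).deriv
  have hsmooth : ContDiff ℝ ((⊤ : ℕ∞) : WithTop ℕ∞) p := by
    rw [contDiff_infty_iff_deriv, hd]
    exact ⟨fun t => (hderiv t).differentiableAt, φ.contDiff⟩
  have hsupp : ∀ t, t ∉ Icc (-R) R → p t = 0 := fun t ht => by
    rw [mem_Icc, not_and_or, not_le, not_le] at ht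
    rcases ht with ht | ht
    · refine (intervalIntegral.integral_congr fun s hs => ?_).trans
        intervalIntegral.integral_zero
      rw [uIcc_of_ge ht.le] at hs
      refine hout s ?_
      have := neg_le_abs s
      linarith [hs.2]
    · rw [hp, ← h]
      refine intervalIntegral.integral_eq_integral_of_support_subset fun s hs => ?_
      rw [Function.mem_support] at hs
      have h1 : |s| < R := lt_of_not_ge fun h' => hs (hout s h')
      rw [abs_lt] at h1
      exact ⟨h1.1, by linarith⟩
  refine ⟨⟨p, hsmooth, HasCompactSupport.intro isCompact_Icc hsupp, fun _ _ => trivial⟩, ?_⟩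
  ext t
  rw [lineDeriv_testFunction_apply]
  exact (hderiv t).deriv

/-- Zero derivative makes `T` a constant, which can be read off by testing on the negative
half-line, where `T` vanishes. -/
theorem IsCausal.eq_zero_of_distDeriv_eq_zero {T : 𝓓'((⊤ : TopologicalSpace.Opens ℝ), X)}
    (hT : IsCausal T) (h : DistExt.distDeriv T = 0) : T = 0 := by
  have hbump : ∃ ρ : 𝓓((⊤ : TopologicalSpace.Opens ℝ), ℝ),
      tsupport ρ ⊆ Iio 0 ∧ ∫ t, ρ t = 1 := by
    -- Centre -3 and outer radius 2 put the support in `[-5, -1]`.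
    let b : ContDiffBump (-3 : ℝ) := ⟨1, 2, one_pos, one_lt_two⟩
    refine ⟨⟨b.normed volume, b.contDiff_normed, b.hasCompactSupport_normed,
      fun _ _ => trivial⟩, ?_, b.integral_normed⟩
    change tsupport (b.normed volume) ⊆ Iio 0
    rw [b.tsupport_normed_eq, Real.closedBall_eq_Icc]
    intro t ht
    have h2 : t ≤ -3 + 2 := ht.2
    rw [mem_Iio]
    linarith
  obtain ⟨ρ, hρ, hρ1⟩ := hbump
  ext φ
  have hi : ∀ φ : 𝓓((⊤ : TopologicalSpace.Opens ℝ), ℝ), Integrable φ := fun φ =>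
    φ.continuous.integrable_of_hasCompactSupport φ.hasCompactSupport
  -- Subtracting `(∫ φ) ρ` leaves a test function of integral zero, that is a derivative, so `T φ =
  -- (∫ φ) T ρ = 0`.
  obtain ⟨ψ, hψ⟩ := exists_lineDeriv_eq_of_integral_eq_zero (φ - (∫ t, φ t) • ρ) (by
    have : ∀ t, (φ - (∫ t, φ t) • ρ) t = φ t - (∫ t, φ t) * ρ t := fun t => rfl
    simp_rw [this]
    rw [integral_sub (hi φ) ((hi ρ).const_mul _), integral_const_mul, hρ1, mul_one, sub_self])
  have h1 : DistExt.distDeriv T ψ = 0 := by rw [h]; rfl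
  rw [distDeriv_apply, hψ, neg_eq_zero, map_sub, map_smul, hT ρ hρ, smul_zero, sub_zero] at h1
  exact h1

theorem IsCausal.eq_zero_of_distDeriv_iterate_eq_zero
    {T : 𝓓'((⊤ : TopologicalSpace.Opens ℝ), X)} (hT : IsCausal T) {k : ℕ}
    (h : DistExt.distDeriv^[k] T = 0) : T = 0 := by
  induction k with
  | zero => exact h
  | succ k ih =>
    rw [Function.iterate_succ_apply'] at h
    exact ih ((hT.distDeriv_iterate k).eq_zero_of_distDeriv_eq_zero h)

theorem eq_zero_of_regDist_eq_zero [CompleteSpace X] {f : ℝ → X} (hf : Continuous f)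
    (h : regDist f = 0) : f = 0 := by
  have hae : ∀ᵐ t, f t = 0 := by
    refine ae_eq_zero_of_integral_contDiff_smul_eq_zero hf.locallyIntegrable fun g hg hgs => ?_
    have h1 : regDist f ⟨g, hg, hgs, fun _ _ => trivial⟩ = 0 := by rw [h]; rfl
    rwa [regDist_apply hf.locallyIntegrable] at h1
  exact (Continuous.ae_eq_iff_eq volume hf continuous_const).1 hae

end Distributions

/-! ### Construction of the contraction semigroup by bounded approximation. -/

section Semigroup

open Filter Topology

variable {H : Type*} [NormedAddCommGroup H] [InnerProductSpace ℝ H] [CompleteSpace H]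

omit [CompleteSpace H] in
-- The energy estimate behind both the contractivity of the exponentials and uniqueness: `‖y‖²` has
-- derivative `2 (y, y')`.
theorem antitoneOn_norm_of_inner_deriv_nonpos {y y' : ℝ → H}
    (hy : ∀ t, 0 ≤ t → HasDerivWithinAt y (y' t) (Ici 0) t)
    (h : ∀ t, 0 ≤ t → inner ℝ (y' t) (y t) ≤ 0) {t : ℝ} (ht : 0 ≤ t) : ‖y t‖ ≤ ‖y 0‖ := by
  have hanti : AntitoneOn (fun t => ‖y t‖ ^ 2) (Ici 0) := by
    refine antitoneOn_of_hasDerivWithinAt_nonpos (convex_Ici 0)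
      (f' := fun t => 2 * inner ℝ (y t) (y' t))
      (fun t ht => (hy t ht).norm_sq.continuousWithinAt) (fun t ht => ?_) fun t ht => ?_
    · rw [interior_Ici] at ht ⊢
      exact (hy t (le_of_lt ht)).norm_sq.mono Ioi_subset_Ici_self
    · rw [interior_Ici] at ht
      have := h t (le_of_lt ht)
      rw [real_inner_comm] at this
      linarith
  have := hanti self_mem_Ici ht ht
  exact le_of_sq_le_sq this (norm_nonneg _)

theorem norm_exp_smul_apply_le {A : H →L[ℝ] H} (hA : ∀ x, inner ℝ (A x) x ≤ 0) {t : ℝ}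
    (ht : 0 ≤ t) (x : H) : ‖NormedSpace.exp (t • A) x‖ ≤ ‖x‖ := by
  have h := antitoneOn_norm_of_inner_deriv_nonpos (y := fun t => NormedSpace.exp (t • A) x)
    (y' := fun t => A (NormedSpace.exp (t • A) x))
    (fun t _ => ((hasDerivAt_exp_smul_const' A t).clm_apply
      (hasDerivAt_const t x)).hasDerivWithinAt.congr_deriv (by simp)) (fun t _ => hA _) ht
  simpa using h

/-- Interpolate between the two exponentials by `s ↦ exp((t - s) A') exp(s A) x`; by commutation its
derivative is a product of contractions applied to `(A - A') x`. -/
theorem norm_exp_smul_sub_exp_smul_apply_le {A A' : H →L[ℝ] H}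
    (hA : ∀ x, inner ℝ (A x) x ≤ 0) (hA' : ∀ x, inner ℝ (A' x) x ≤ 0) (hc : Commute A A')
    {t : ℝ} (ht : 0 ≤ t) (x : H) :
    ‖NormedSpace.exp (t • A) x - NormedSpace.exp (t • A') x‖ ≤ t * ‖A x - A' x‖ := by
  let _ : NormedAlgebra ℚ (H →L[ℝ] H) := NormedAlgebra.restrictScalars ℚ ℝ _
  have hexp : ∀ s : ℝ, NormedSpace.exp (t • A') * NormedSpace.exp (s • (A - A')) =
      NormedSpace.exp ((t - s) • A') * NormedSpace.exp (s • A) := fun s => by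
    rw [← NormedSpace.exp_add_of_commute, ← NormedSpace.exp_add_of_commute]
    · congr 1
      module
    · exact ((hc.symm.smul_left _).smul_right _)
    · exact (((hc.symm.sub_right (Commute.refl A')).smul_left _).smul_right _)
  have hd : ∀ s : ℝ, HasDerivAt
      (fun s : ℝ => (NormedSpace.exp (t • A') * NormedSpace.exp (s • (A - A'))) x)
      ((NormedSpace.exp ((t - s) • A') * NormedSpace.exp (s • A)) ((A - A') x)) s := fun s => by
    have h1 := (hasDerivAt_exp_smul_const (A - A') s).const_mul (NormedSpace.exp (t • A'))
    have h2 := h1.clm_apply (hasDerivAt_const s x)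
    refine h2.congr_deriv ?_
    rw [← mul_assoc, hexp]
    simp
  have key := norm_image_sub_le_of_norm_deriv_le_segment'
    (fun s _ => (hd s).hasDerivWithinAt) (C := ‖A x - A' x‖) (a := 0) (b := t)
    (fun s hs => (norm_exp_smul_apply_le hA' (sub_nonneg.2 hs.2.le) _).trans
      (norm_exp_smul_apply_le hA hs.1 _)) t (right_mem_Icc.2 ht)
  rw [hexp t] at key
  simpa [mul_comm] using key

variable {J : H →L[ℝ] H}

/-- A vector `x` orthogonal to the range satisfies `‖J x‖² = (J x, x) = 0`, and injectivity gives `x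
= 0`. -/
theorem dense_range_of_inner_eq_norm_sq (hJ : ∀ x, inner ℝ (J x) x = ‖J x‖ ^ 2)
    (hinj : Function.Injective J) : DenseRange J := by
  have h : (LinearMap.range (J : H →ₗ[ℝ] H)).topologicalClosure = ⊤ := by
    rw [Submodule.topologicalClosure_eq_top_iff, Submodule.eq_bot_iff]
    intro x hx
    have h0 : inner ℝ (J x) x = 0 := hx (J x) ⟨x, rfl⟩
    rw [hJ, sq_eq_zero_iff, norm_eq_zero] at h0
    exact hinj (by rw [h0, map_zero])
  intro x
  have hx : x ∈ (LinearMap.range (J : H →ₗ[ℝ] H)).topologicalClosure := by rw [h]; trivial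
  exact hx

/-- The inverse of `c + J`, for `c > 0` and `J` monotone. -/
theorem exists_inverse_smul_one_add (hJ : ∀ x, inner ℝ (J x) x = ‖J x‖ ^ 2) {c : ℝ}
    (hc : 0 < c) :
    ∃ E : H →L[ℝ] H, (∀ x, c • E x + J (E x) = x) ∧ (∀ x, c • E x + E (J x) = x) ∧
      (∀ x, ‖c • E x‖ ≤ ‖x‖) := by
  have hu : IsUnit (c • (1 : H →L[ℝ] H) + J) := by
    -- Coercivity: `((c + J) x, x) = c ‖x‖² + ‖J x‖²`.
    refine ContinuousLinearMap.isUnit_of_forall_le_norm_inner_map _ (c := ⟨c, hc.le⟩) hc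
      fun x => ?_
    have h1 : inner ℝ ((c • (1 : H →L[ℝ] H) + J) x) x = c * ‖x‖ ^ 2 + ‖J x‖ ^ 2 := by
      simp [inner_add_left, inner_smul_left, hJ]
    rw [h1, Real.norm_of_nonneg (by positivity)]
    change ‖x‖ ^ 2 * c ≤ _
    nlinarith [sq_nonneg ‖J x‖]
  obtain ⟨u, hu⟩ := hu
  set E : H →L[ℝ] H := ↑u⁻¹ with hE
  have h1 : ∀ x, c • E x + J (E x) = x := fun x => by
    have := congrArg (fun L : H →L[ℝ] H => L x) u.mul_inv
    rw [hu] at this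
    simpa using this
  have h2 : ∀ x, c • E x + E (J x) = x := fun x => by
    have := congrArg (fun L : H →L[ℝ] H => L x) u.inv_mul
    rw [hu] at this
    simpa using this
  refine ⟨E, h1, h2, fun x => ?_⟩
  -- In the expanded square the cross term is `2 c ‖J (E x)‖² ≥ 0`, so dropping it and the last
  -- square gives the bound.
  have h3 : ‖c • E x + J (E x)‖ ^ 2 = ‖x‖ ^ 2 := by rw [h1]
  rw [norm_add_sq_real, inner_smul_left, real_inner_comm, hJ] at h3
  refine le_of_sq_le_sq ?_ (norm_nonneg _)
  simp only [conj_trivial] at h3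
  nlinarith [sq_nonneg ‖J (E x)‖, mul_nonneg hc.le (sq_nonneg ‖J (E x)‖)]

/-- Bounded dissipative approximations of the generator `1 - J⁻¹`. -/
theorem exists_bounded_approximations (hJ : ∀ x, inner ℝ (J x) x = ‖J x‖ ^ 2)
    (hinj : Function.Injective J) :
    ∃ A : ℕ → H →L[ℝ] H, (∀ n x, inner ℝ (A n x) x ≤ 0) ∧ (∀ n m, Commute (A n) (A m)) ∧
      (∀ z, Tendsto (fun n => A n (J z)) atTop (𝓝 (J z - z))) ∧
      (∀ (y : ℕ → H) (x : H), Tendsto y atTop (𝓝 x) →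
        Tendsto (fun n => J (A n (y n))) atTop (𝓝 (J x - x))) ∧
      ∃ C, ∀ n x, ‖J (A n x)‖ ≤ C * ‖x‖ := by
  set c : ℕ → ℝ := fun n => 1 / ((n : ℝ) + 1) with hcdef
  have hc : ∀ n, 0 < c n := fun n => by positivity
  have hc0 : Tendsto c atTop (𝓝 0) := tendsto_one_div_add_atTop_nhds_zero_nat
  choose E hE1 hE2 hE3 using fun n => exists_inverse_smul_one_add hJ (hc n)
  have hdense := dense_range_of_inner_eq_norm_sq hJ hinj
  have hJE : ∀ n x, J (E n x) = E n (J x) := fun n x => by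
    have := (hE1 n x).trans (hE2 n x).symm
    exact add_left_cancel this
  have hEE : ∀ n m x, E n (E m x) = E m (E n x) := fun n m x => by
    have h1 : E n (c m • E m x + J (E m x)) = E n x := by rw [hE1]
    have h2 : c m • E m (E n x) + J (E m (E n x)) = E n x := hE1 m _
    rw [map_add, map_smul, ← hJE] at h1
    -- The commutator applied to `x` is annihilated by `c m + J`, which has the left inverse `E m`.
    set d := E n (E m x) - E m (E n x) with hd
    have h3 : c m • d + J d = 0 := by
      rw [hd, map_sub, smul_sub]
      rw [← sub_eq_zero] at h1 h2
      calc _ = (c m • E n (E m x) + J (E n (E m x)) - E n x) -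
            (c m • E m (E n x) + J (E m (E n x)) - E n x) := by abel
        _ = 0 := by rw [h1, h2, sub_zero]
    have h4 : d = 0 := by
      have := congrArg (E m) h3
      rw [map_add, map_smul, hE2, map_zero] at this
      exact this
    exact sub_eq_zero.1 h4
  -- `c n • E n → 0` strongly: the operators are contractions, and on the dense range of `J` one has
  -- `c n • E n (J z) = c n • (z - c n • E n z)`, of norm at most `2 c n ‖z‖`.
  have hlim : ∀ (y : ℕ → H) (x : H), Tendsto y atTop (𝓝 x) →
      Tendsto (fun n => c n • E n (y n)) atTop (𝓝 0) := fun y x hy => by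
    rw [Metric.tendsto_atTop]
    intro ε hε
    obtain ⟨z, hz⟩ := hdense.exists_dist_lt x (ε := ε / 3) (by positivity)
    rw [dist_eq_norm] at hz
    have hcz : Tendsto (fun n => c n * (2 * ‖z‖)) atTop (𝓝 0) := by
      simpa using hc0.mul_const (2 * ‖z‖)
    obtain ⟨N, hN⟩ := eventually_atTop.1 ((hcz.eventually_lt_const
      (show 0 < ε / 3 by positivity)).and (Metric.tendsto_nhds.1 hy (ε / 3) (by positivity)))
    refine ⟨N, fun n hn => ?_⟩
    obtain ⟨h1, h2⟩ := hN n hn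
    rw [dist_eq_norm] at h2
    rw [dist_zero_right]
    have h3 : c n • E n (y n) = c n • E n (y n - x) + c n • E n (x - J z) + c n • E n (J z) := by
      rw [← smul_add, ← smul_add, ← map_add, ← map_add]
      congr 2
      abel
    have h4 : ‖c n • E n (J z)‖ ≤ c n * (2 * ‖z‖) := by
      rw [norm_smul, Real.norm_of_nonneg (hc n).le]
      refine mul_le_mul_of_nonneg_left ?_ (hc n).le
      have h5 : E n (J z) = z - c n • E n z := by rw [eq_sub_iff_add_eq, add_comm, hE2]
      rw [h5]
      calc _ ≤ ‖z‖ + ‖c n • E n z‖ := norm_sub_le _ _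
        _ ≤ 2 * ‖z‖ := by linarith [hE3 n z]
    calc ‖c n • E n (y n)‖ ≤ ‖c n • E n (y n - x)‖ + ‖c n • E n (x - J z)‖ +
          ‖c n • E n (J z)‖ := by rw [h3]; exact norm_add₃_le
      _ < ε := by linarith [hE3 n (y n - x), hE3 n (x - J z)]
  -- Regularise `1 - J⁻¹ = (J - 1) J⁻¹` to `(J - 1) (c n + J)⁻¹`. Both limits rest on `E n J = J E n
  -- = 1 - c n E n`, whose norm is at most 2.
  refine ⟨fun n => (J - 1) * E n, fun n x => ?_, fun n m => ?_, fun z => ?_, fun y x hy => ?_,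
    ‖J - 1‖ * 2, fun n x => ?_⟩
  · have hx := hE1 n x
    set y := E n x with hy
    have h1 : inner ℝ (((J - 1) * E n) x) x = c n * (‖J y‖ ^ 2 - ‖y‖ ^ 2) := by
      have h2 : ((J - 1) * E n) x = J y - y := by simp [hy]
      rw [h2]
      conv_lhs => rw [← hx]
      simp only [inner_sub_left, inner_add_right, inner_smul_right, hJ,
        real_inner_self_eq_norm_sq, real_inner_comm (J y) y]
      ring
    rw [h1]
    have h3 : ‖J y‖ ^ 2 ≤ ‖J y‖ * ‖y‖ := by rw [← hJ]; exact real_inner_le_norm _ _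
    have h4 : ‖J y‖ ≤ ‖y‖ := by
      by_contra! h
      nlinarith [norm_nonneg y]
    have h5 : ‖J y‖ ^ 2 ≤ ‖y‖ ^ 2 := pow_le_pow_left₀ (norm_nonneg _) h4 2
    exact mul_nonpos_of_nonneg_of_nonpos (hc n).le (by linarith)
  · ext x
    simp only [mul_apply_eq_comp, sub_apply,
      one_apply_eq_self, map_sub, ← hJE, hEE n m]
  · have h : ∀ n, ((J - 1) * E n) (J z) = (J - 1) (z - c n • E n z) := fun n => by
      rw [mul_apply_eq_comp]
      congr 1
      rw [eq_sub_iff_add_eq, add_comm, hE2]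
    simp_rw [h]
    have h1 : Tendsto (fun n => z - c n • E n z) atTop (𝓝 (z - 0)) :=
      tendsto_const_nhds.sub (hlim (fun _ => z) z tendsto_const_nhds)
    rw [sub_zero] at h1
    exact ((J - 1).continuous.tendsto z).comp h1
  · have h : ∀ n, J (((J - 1) * E n) (y n)) = (J - 1) (y n - c n • E n (y n)) := fun n => by
      have h1 : y n - c n • E n (y n) = J (E n (y n)) := by
        rw [sub_eq_iff_eq_add, add_comm, hE1]
      rw [h1]
      simp
    simp_rw [h]
    have h1 : Tendsto (fun n => y n - c n • E n (y n)) atTop (𝓝 (x - 0)) := hy.sub (hlim y x hy)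
    rw [sub_zero] at h1
    exact ((J - 1).continuous.tendsto x).comp h1
  · have h1 : J (((J - 1) * E n) x) = (J - 1) (x - c n • E n x) := by
      have h1 : x - c n • E n x = J (E n x) := by
        rw [sub_eq_iff_eq_add, add_comm, hE1]
      rw [h1]
      simp
    rw [h1, mul_assoc]
    refine ((J - 1).le_opNorm _).trans (mul_le_mul_of_nonneg_left ?_ (norm_nonneg _))
    calc _ ≤ ‖x‖ + ‖c n • E n x‖ := norm_sub_le _ _
      _ ≤ 2 * ‖x‖ := by linarith [hE3 n x]

/-- The contraction semigroup generated by `1 - J⁻¹` (extended by the identity to negative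
times). -/
theorem exists_contraction_semigroup (hJ : ∀ x, inner ℝ (J x) x = ‖J x‖ ^ 2)
    (hinj : Function.Injective J) :
    ∃ S : ℝ → H → H, (∀ t x, ‖S t x‖ ≤ ‖x‖) ∧ (Continuous fun p : ℝ × H => S p.1 p.2) ∧
      ∀ t, 0 ≤ t → ∀ x, J (S t x) = J x + ∫ s in (0 : ℝ)..t, (J (S s x) - S s x) := by
  obtain ⟨A, hdiss, hcomm, hlim, hJlim, C, hC⟩ := exists_bounded_approximations hJ hinj
  have hdense := dense_range_of_inner_eq_norm_sq hJ hinj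
  -- Freezing negative times at 0 makes contractivity and joint continuity hold on the whole line.
  set Sn : ℕ → ℝ → H →L[ℝ] H := fun n t => NormedSpace.exp (max t 0 • A n) with hSn
  have hSn1 : ∀ n t x, ‖Sn n t x‖ ≤ ‖x‖ := fun n t x =>
    norm_exp_smul_apply_le (hdiss n) (le_max_right _ _) x
  have hcauchy : ∀ t x, CauchySeq fun n => Sn n t x := fun t x => by
    rw [Metric.cauchySeq_iff]
    intro ε hε
    obtain ⟨z, hz⟩ := hdense.exists_dist_lt x (ε := ε / 3) (by positivity)
    rw [dist_eq_norm] at hz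
    set T := max t 0 with hT
    have hT0 : 0 ≤ T := le_max_right _ _
    have hTpos : 0 < T + 1 := by linarith
    -- Dividing by `T + 1` rather than `T` covers `T = 0`.
    obtain ⟨N, hN⟩ := Metric.cauchySeq_iff.1 (hlim z).cauchySeq (ε / 3 / (T + 1)) (by positivity)
    refine ⟨N, fun n hn m hm => ?_⟩
    have h1 := norm_exp_smul_sub_exp_smul_apply_le (hdiss n) (hdiss m) (hcomm n m) hT0 (J z)
    have h2 := hN n hn m hm
    rw [dist_eq_norm, lt_div_iff₀ hTpos] at h2
    have h3 : Sn n t x - Sn m t x =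
        Sn n t (x - J z) + (Sn n t (J z) - Sn m t (J z)) - Sn m t (x - J z) := by
      simp only [map_sub]
      abel
    rw [dist_eq_norm, h3]
    have h4 : ‖Sn n t (J z) - Sn m t (J z)‖ < ε / 3 := by
      refine h1.trans_lt ?_
      nlinarith [norm_nonneg (A n (J z) - A m (J z))]
    calc _ ≤ ‖Sn n t (x - J z)‖ + ‖Sn n t (J z) - Sn m t (J z)‖ + ‖Sn m t (x - J z)‖ :=
          (norm_sub_le _ _).trans (add_le_add_left (norm_add_le _ _) _)
      _ < ε := by linarith [hSn1 n t (x - J z), hSn1 m t (x - J z)]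
  choose S hS using fun t x => cauchySeq_tendsto_of_complete (hcauchy t x)
  have hS1 : ∀ t x y, ‖S t x - S t y‖ ≤ ‖x - y‖ := fun t x y =>
    le_of_tendsto ((hS t x).sub (hS t y)).norm (Eventually.of_forall fun n => by
      rw [← map_sub]; exact hSn1 n t _)
  -- On the range of `J` the orbits are Lipschitz in time, since `A n (J z)` converges to `J z - z`;
  -- density then gives joint continuity.
  have hS2 : ∀ t s z, ‖S t (J z) - S s (J z)‖ ≤ ‖J z - z‖ * |t - s| := fun t s z => by
    refine le_of_tendsto_of_tendsto ((hS t (J z)).sub (hS s (J z))).norm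
      ((hlim z).norm.mul_const |t - s|) (Eventually.of_forall fun n => ?_)
    have hd : ∀ r ∈ Ici (0 : ℝ), HasDerivWithinAt (fun r : ℝ => NormedSpace.exp (r • A n) (J z))
        (NormedSpace.exp (r • A n) (A n (J z))) (Ici 0) r := fun r _ =>
      (((hasDerivAt_exp_smul_const (A n) r).clm_apply
        (hasDerivAt_const r (J z))).congr_deriv (by simp)).hasDerivWithinAt
    have h1 := (convex_Ici (0 : ℝ)).norm_image_sub_le_of_norm_hasDerivWithin_le hd
      (fun r hr => norm_exp_smul_apply_le (hdiss n) hr _)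
      (mem_Ici.2 (le_max_right s 0)) (mem_Ici.2 (le_max_right t 0))
    refine h1.trans (mul_le_mul_of_nonneg_left ?_ (norm_nonneg _))
    exact abs_max_sub_max_le_abs t s 0
  have hScont : Continuous fun p : ℝ × H => S p.1 p.2 := by
    rw [continuous_iff_continuousAt]
    rintro ⟨t₀, x₀⟩
    rw [ContinuousAt, Metric.tendsto_nhds]
    intro ε hε
    obtain ⟨z, hz⟩ := hdense.exists_dist_lt x₀ (ε := ε / 4) (by positivity)
    have hb : Tendsto (fun p : ℝ × H => ‖p.2 - J z‖ + ‖J z - z‖ * |p.1 - t₀| + ‖J z - x₀‖)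
        (𝓝 (t₀, x₀)) (𝓝 (‖x₀ - J z‖ + ‖J z - z‖ * |t₀ - t₀| + ‖J z - x₀‖)) :=
      Continuous.tendsto (by fun_prop) (t₀, x₀)
    rw [dist_eq_norm] at hz
    have hlt : ‖x₀ - J z‖ + ‖J z - z‖ * |t₀ - t₀| + ‖J z - x₀‖ < ε := by
      rw [norm_sub_rev (J z) x₀]
      simp only [sub_self, abs_zero, mul_zero]
      linarith
    filter_upwards [hb.eventually_lt_const hlt] with p hp
    refine lt_of_le_of_lt ?_ hp
    rw [dist_eq_norm]
    have h3 : S p.1 p.2 - S t₀ x₀ = (S p.1 p.2 - S p.1 (J z)) + (S p.1 (J z) - S t₀ (J z)) +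
        (S t₀ (J z) - S t₀ x₀) := by abel
    rw [h3]
    exact norm_add₃_le.trans (add_le_add (add_le_add (hS1 _ _ _) (hS2 _ _ _)) (hS1 _ _ _))
  refine ⟨S, fun t x => ?_, hScont, fun t ht x => ?_⟩
  · exact le_of_tendsto (hS t x).norm (Eventually.of_forall fun n => hSn1 n t x)
  · have hSncont : ∀ n, Continuous fun s => Sn n s x := fun n => by
      have h1 : Continuous fun s : ℝ => NormedSpace.exp (s • A n) := continuous_iff_continuousAt.2
        fun s => (hasDerivAt_exp_smul_const (A n) s).continuousAt
      have h2 : Continuous fun s : ℝ => Sn n s := h1.comp (by fun_prop)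
      exact h2.clm_apply continuous_const
    -- Applying `J` makes the evolution equation meaningful for every `x`: `J (A n ·)` is uniformly
    -- bounded and converges along the orbits, so dominated convergence applies.
    have heq : ∀ n, J (Sn n t x) = J x + ∫ s in (0 : ℝ)..t, J (A n (Sn n s x)) := fun n => by
      have h := intervalIntegral.integral_eq_sub_of_hasDerivAt (a := 0) (b := t)
        (f := fun s : ℝ => J (NormedSpace.exp (s • A n) x))
        (f' := fun s : ℝ => J (A n (NormedSpace.exp (s • A n) x)))
        (fun s _ => (J.hasFDerivAt.comp_hasDerivAt s
          ((hasDerivAt_exp_smul_const' (A n) s).clm_apply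
            (hasDerivAt_const s x))).congr_deriv (by simp))
        (Continuous.intervalIntegrable (J.continuous.comp ((A n).continuous.comp
          (Continuous.clm_apply (continuous_iff_continuousAt.2
            fun s => (hasDerivAt_exp_smul_const (A n) s).continuousAt) continuous_const))) _ _)
      have h2 : ∫ s in (0 : ℝ)..t, J (A n (Sn n s x)) =
          ∫ s in (0 : ℝ)..t, J (A n (NormedSpace.exp (s • A n) x)) := by
        refine intervalIntegral.integral_congr fun s hs => ?_
        rw [uIcc_of_le ht] at hs
        simp only [hSn, max_eq_left hs.1]
      rw [h2, h]
      simp [hSn, max_eq_left ht]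
    have h1 : Tendsto (fun n => J (Sn n t x)) atTop (𝓝 (J (S t x))) :=
      (J.continuous.tendsto _).comp (hS t x)
    have h2 : Tendsto (fun n => ∫ s in (0 : ℝ)..t, J (A n (Sn n s x))) atTop
        (𝓝 (∫ s in (0 : ℝ)..t, (J (S s x) - S s x))) := by
      refine intervalIntegral.tendsto_integral_filter_of_dominated_convergence
        (fun _ => |C| * ‖x‖) (Eventually.of_forall fun n => ?_)
        (Eventually.of_forall fun n => Eventually.of_forall fun s _ => ?_)
        intervalIntegrable_const (Eventually.of_forall fun s _ => hJlim _ _ (hS s x))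
      · exact (J.continuous.comp ((A n).continuous.comp (hSncont n))).aestronglyMeasurable
      · refine (hC n _).trans ?_
        exact mul_le_mul (le_abs_self C) (hSn1 n s x) (norm_nonneg _) (abs_nonneg _)
    refine tendsto_nhds_unique h1 ?_
    simp_rw [heq]
    exact tendsto_const_nhds.add h2

end Semigroup

/-! ### Duhamel's formula for a locally integrable source. -/

section MildSolution

open Filter Topology

variable {H : Type*} [NormedAddCommGroup H] [InnerProductSpace ℝ H] [CompleteSpace H]

/-- The mild solution of `w' = (1 - J⁻¹) w + h`, `w(0) = 0`, with locally integrable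
right-hand side. -/
theorem exists_mild_solution {J : H →L[ℝ] H} (hJ : ∀ x, inner ℝ (J x) x = ‖J x‖ ^ 2)
    (hinj : Function.Injective J) {h : ℝ → H} (hloc : LocallyIntegrable h)
    (hneg : ∀ t ≤ 0, h t = 0) :
    ∃ w : ℝ → H, Continuous w ∧ (∀ t, 0 ≤ t → ‖w t‖ ≤ ∫ τ in (0 : ℝ)..t, ‖h τ‖) ∧ w 0 = 0 ∧
      ∀ t, 0 ≤ t → J (w t) =
        J (∫ τ in (0 : ℝ)..t, h τ) + ∫ s in (0 : ℝ)..t, (J (w s) - w s) := by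
  obtain ⟨S, hS1, hScont, hSJ⟩ := exists_contraction_semigroup hJ hinj
  have hint : ∀ T, Integrable ((Iio T).indicator h) := fun T => by
    rw [integrable_indicator_iff measurableSet_Iio]
    refine ((hloc.integrableOn_isCompact (isCompact_Icc (a := 0) (b := T)))).of_forall_sdiff_eq_zero
      measurableSet_Iio fun τ hτ => hneg τ ?_
    by_contra! hcon
    exact hτ.2 ⟨hcon.le, le_of_lt hτ.1⟩
  have hmeas : AEStronglyMeasurable h := hloc.aestronglyMeasurable
  have hS0 : ∀ t, S t 0 = 0 := fun t => norm_le_zero_iff.1 (by simpa using hS1 t 0)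
  -- The Duhamel kernel, cut off at `τ = t` so that every integral runs over one fixed domain.
  set K : ℝ → ℝ → H := fun τ t => if τ < t then S (t - τ) (h τ) else 0 with hK
  have hKle : ∀ T τ t, t ≤ T → ‖K τ t‖ ≤ ‖(Iio T).indicator h τ‖ := fun T τ t hT => by
    simp only [hK]
    split_ifs with hτ
    · rw [indicator_of_mem (mem_Iio.2 (hτ.trans_le hT))]
      exact hS1 _ _
    · simp
  have hKmeas : ∀ t, AEStronglyMeasurable (fun τ => K τ t) := fun t => by
    have h1 : AEStronglyMeasurable fun τ => S (t - τ) (h τ) :=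
      hScont.comp_aestronglyMeasurable
        ((by fun_prop : Continuous fun τ : ℝ => t - τ).aestronglyMeasurable.prodMk hmeas)
    have h2 : (fun τ => K τ t) = (Iio t).indicator fun τ => S (t - τ) (h τ) := by
      ext τ
      simp [hK, indicator_apply]
    rw [h2]
    exact h1.indicator measurableSet_Iio
  have hKint : ∀ t, Integrable fun τ => K τ t := fun t =>
    (hint t).norm.mono' (hKmeas t) (Eventually.of_forall fun τ => hKle t τ t le_rfl)
  set w : ℝ → H := fun t => ∫ τ, K τ t with hw
  have hwcont : Continuous w := by
    rw [continuous_iff_continuousAt]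
    intro t₀
    refine continuousAt_of_dominated (bound := fun τ => ‖(Iio (t₀ + 1)).indicator h τ‖)
      (Eventually.of_forall hKmeas) ?_ (hint _).norm ?_
    · filter_upwards [Iio_mem_nhds (lt_add_one t₀)] with t ht
      exact Eventually.of_forall fun τ => hKle _ τ t (le_of_lt ht)
    -- The kernel may jump in `t` only at `t = τ`, so one null set is discarded.
    filter_upwards [Measure.ae_ne volume t₀] with τ hτ
    rcases lt_or_gt_of_ne hτ with hlt | hlt
    · have h1 : ContinuousAt (fun t => S (t - τ) (h τ)) t₀ :=
        (hScont.comp (by fun_prop : Continuous fun t : ℝ => (t - τ, h τ))).continuousAt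
      refine h1.congr ?_
      filter_upwards [Ioi_mem_nhds hlt] with t ht
      exact (if_pos ht).symm
    · have h1 : ContinuousAt (fun _ : ℝ => (0 : H)) t₀ := continuousAt_const
      refine h1.congr ?_
      filter_upwards [Iio_mem_nhds hlt] with t ht
      exact (if_neg (not_lt.2 (le_of_lt ht))).symm
  refine ⟨w, hwcont, fun t ht => ?_, ?_, fun t ht => ?_⟩
  · refine (norm_integral_le_of_norm_le (hint t).norm
      (Eventually.of_forall fun τ => hKle t τ t le_rfl)).trans_eq ?_
    simp_rw [norm_indicator_eq_indicator_norm]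
    rw [integral_indicator measurableSet_Iio, ← integral_Iic_eq_integral_Iio,
      intervalIntegral.integral_of_le ht]
    refine setIntegral_eq_of_subset_of_forall_sdiff_eq_zero measurableSet_Iic
      Ioc_subset_Iic_self fun τ hτ => ?_
    rw [hneg τ, norm_zero]
    by_contra! hcon
    exact hτ.2 ⟨hcon, hτ.1⟩
  · refine (integral_congr_ae (Eventually.of_forall fun τ => ?_)).trans (integral_zero ℝ H)
    simp only [hK]
    split_ifs with hτ
    · rw [hneg τ hτ.le, hS0]
    · rfl
  -- The semigroup identity for each `h τ`, started at time `τ`. Integrating over `τ` and exchanging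
  -- integrals yields the mild equation.
  · have hpt : ∀ τ, J (K τ t) = (Iio t).indicator (fun τ => J (h τ)) τ +
        ∫ s in (0 : ℝ)..t, (J (K τ s) - K τ s) := fun τ => by
      rcases le_or_gt τ 0 with hτ0 | hτ0
      · have : ∀ s, K τ s = 0 := fun s => by simp [hK, hneg τ hτ0, hS0]
        simp [this, hneg τ hτ0, indicator_apply]
      rcases lt_or_ge τ t with hτ | hτ
      · have hcont : Continuous fun s => J (S s (h τ)) - S s (h τ) := by
          have h1 : Continuous fun s => S s (h τ) :=
            hScont.comp (by fun_prop : Continuous fun s : ℝ => (s, h τ))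
          exact (J.continuous.comp h1).sub h1
        have h1 : ∫ s in (0 : ℝ)..τ, (J (K τ s) - K τ s) = 0 := by
          refine (intervalIntegral.integral_congr fun s hs => ?_).trans
            intervalIntegral.integral_zero
          rw [uIcc_of_le hτ0.le] at hs
          simp [hK, not_lt.2 hs.2]
        have h2 : EqOn (fun s => J (K τ s) - K τ s)
            (fun s => J (S (s - τ) (h τ)) - S (s - τ) (h τ)) (Ioc τ t) := fun s hs => by
          simp [hK, hs.1]
        have h3 : IntervalIntegrable (fun s => J (K τ s) - K τ s) volume τ t := by
          rw [intervalIntegrable_iff_integrableOn_Ioc_of_le hτ.le,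
            integrableOn_congr_fun h2 measurableSet_Ioc,
            ← intervalIntegrable_iff_integrableOn_Ioc_of_le hτ.le]
          exact (hcont.comp (by fun_prop : Continuous fun s : ℝ => s - τ)).intervalIntegrable _ _
        have h4 : IntervalIntegrable (fun s => J (K τ s) - K τ s) volume 0 τ := by
          have h5 : EqOn (fun s => J (K τ s) - K τ s) (fun _ => 0) (Ioc 0 τ) := fun s hs => by
            simp [hK, not_lt.2 hs.2]
          rw [intervalIntegrable_iff_integrableOn_Ioc_of_le hτ0.le,
            integrableOn_congr_fun h5 measurableSet_Ioc]
          exact integrableOn_zero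
        rw [← intervalIntegral.integral_add_adjacent_intervals h4 h3, h1, zero_add,
          indicator_of_mem (mem_Iio.2 hτ), intervalIntegral.integral_of_le hτ.le,
          setIntegral_congr_fun measurableSet_Ioc h2, ← intervalIntegral.integral_of_le hτ.le,
          intervalIntegral.integral_comp_sub_right (fun s => J (S s (h τ)) - S s (h τ)), sub_self]
        simp only [hK, if_pos hτ]
        exact hSJ _ (sub_nonneg.2 hτ.le) _
      · have h1 : ∫ s in (0 : ℝ)..t, (J (K τ s) - K τ s) = 0 := by
          refine (intervalIntegral.integral_congr fun s hs => ?_).trans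
            intervalIntegral.integral_zero
          rw [uIcc_of_le ht] at hs
          simp [hK, not_lt.2 (hs.2.trans hτ)]
        rw [h1, indicator_of_notMem (notMem_Iio.2 hτ)]
        simp [hK, not_lt.2 hτ]
    have hJh : Integrable ((Iio t).indicator fun τ => J (h τ)) := by
      have h1 : ((Iio t).indicator fun τ => J (h τ)) = fun τ => J ((Iio t).indicator h τ) := by
        ext τ
        simp only [indicator_apply]
        split_ifs <;> simp
      rw [h1]
      exact J.integrable_comp (hint t)
    have hprod : Integrable (Function.uncurry fun s τ => J (K τ s) - K τ s)
        ((volume.restrict (uIoc 0 t)).prod volume) := by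
      have hm : AEStronglyMeasurable (Function.uncurry fun s τ => K τ s)
          ((volume.restrict (uIoc 0 t)).prod volume) := by
        have h1 : AEStronglyMeasurable (fun p : ℝ × ℝ => S (p.1 - p.2) (h p.2))
            ((volume.restrict (uIoc 0 t)).prod volume) :=
          hScont.comp_aestronglyMeasurable
            ((by fun_prop : Continuous fun p : ℝ × ℝ => p.1 - p.2).aestronglyMeasurable.prodMk
              hmeas.comp_snd)
        have h2 : (Function.uncurry fun s τ => K τ s) =
            {p : ℝ × ℝ | p.2 < p.1}.indicator fun p => S (p.1 - p.2) (h p.2) := by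
          ext ⟨s, τ⟩
          simp [hK, indicator_apply]
        rw [h2]
        exact h1.indicator (measurableSet_lt measurable_snd measurable_fst)
      have hK2 : Integrable (Function.uncurry fun s τ => K τ s)
          ((volume.restrict (uIoc 0 t)).prod volume) :=
        by
        have : IsFiniteMeasure (volume.restrict (uIoc 0 t)) := ⟨by simp [uIoc]⟩
        refine ((hint t).norm.comp_snd (volume.restrict (uIoc 0 t))).mono' hm ?_
        have h3 : ∀ᵐ p ∂((volume.restrict (uIoc 0 t)).prod (volume : Measure ℝ)), p.1 ≤ t := by
          refine Measure.quasiMeasurePreserving_fst.ae (p := fun s => s ≤ t) ?_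
          filter_upwards [ae_restrict_mem measurableSet_uIoc] with s hs
          rw [uIoc_of_le ht] at hs
          exact hs.2
        filter_upwards [h3] with p hp
        exact hKle t p.2 p.1 hp
      exact (J.integrable_comp hK2).sub hK2
    have hswap : ∫ s in (0 : ℝ)..t, (J (w s) - w s) =
        ∫ τ, ∫ s in (0 : ℝ)..t, (J (K τ s) - K τ s) := by
      rw [← intervalIntegral_integral_swap hprod]
      refine intervalIntegral.integral_congr fun s _ => ?_
      simp only [hw]
      rw [integral_sub (J.integrable_comp (hKint s)) (hKint s),
        J.integral_comp_comm (hKint s)]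
    have hlast : J (∫ τ in (0 : ℝ)..t, h τ) = ∫ τ, (Iio t).indicator (fun τ => J (h τ)) τ := by
      rw [integral_indicator measurableSet_Iio, ← integral_Iic_eq_integral_Iio,
        intervalIntegral.integral_of_le ht, ← J.integral_comp_comm
          ((hloc.integrableOn_isCompact isCompact_Icc).mono_set Ioc_subset_Icc_self)]
      refine (setIntegral_eq_of_subset_of_forall_sdiff_eq_zero measurableSet_Iic
        Ioc_subset_Iic_self fun τ hτ => ?_).symm
      rw [hneg τ, map_zero]
      by_contra! hcon
      exact hτ.2 ⟨hcon, hτ.1⟩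
    have hinner : Integrable fun τ => ∫ s in (0 : ℝ)..t, (J (K τ s) - K τ s) := by
      have h1 : (fun τ => ∫ s in (0 : ℝ)..t, (J (K τ s) - K τ s)) =
          fun τ => J (K τ t) - (Iio t).indicator (fun τ => J (h τ)) τ := by
        ext τ
        rw [hpt τ, add_sub_cancel_left]
      rw [h1]
      exact (J.integrable_comp (hKint t)).sub hJh
    rw [hswap, hlast, ← integral_add hJh hinner]
    simp_rw [← hpt]
    exact (J.integral_comp_comm (hKint t)).symm

end MildSolution

/-! ### Integral representation of the data. -/

section DataSpaces

open Filter Topology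

variable {X : Type*} [NormedAddCommGroup X] [NormedSpace ℝ X]

theorem exists_integrable_primitive {g h : ℝ → X} (hh : IntegrableOn h (Ioi 0))
    (hg : ∀ t, 0 ≤ t → g t = ∫ τ in (0 : ℝ)..t, h τ) :
    ∃ h' : ℝ → X, Integrable h' ∧ (∀ t ≤ 0, h' t = 0) ∧
      ∀ t, 0 ≤ t → g t = ∫ τ in (0 : ℝ)..t, h' τ := by
  refine ⟨(Ioi 0).indicator h, (integrable_indicator_iff measurableSet_Ioi).2 hh,
    fun t ht => indicator_of_notMem (notMem_Ioi.2 ht) _, fun t ht => ?_⟩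
  rw [hg t ht, intervalIntegral.integral_of_le ht, intervalIntegral.integral_of_le ht]
  exact setIntegral_congr_fun measurableSet_Ioc fun s hs =>
    (indicator_of_mem (mem_Ioi.2 hs.1) _).symm

theorem MemW.exists_integral_eq {f : ℝ → X} (hf : MemW 1 f) :
    ∃ h : ℝ → X, Integrable h ∧ (∀ t ≤ 0, h t = 0) ∧
      ∀ t, 0 ≤ t → f t = ∫ τ in (0 : ℝ)..t, h τ := by
  obtain ⟨-, -, -, h, hh, hfh⟩ := hf
  refine exists_integrable_primitive hh fun t ht => ?_
  simpa using hfh t ht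

theorem MemW.exists_hasDerivWithinAt {f : ℝ → X} (hf : MemW 2 f) :
    f 0 = 0 ∧ ∃ h : ℝ → X, Integrable h ∧ (∀ t ≤ 0, h t = 0) ∧
      ∀ t, 0 ≤ t → HasDerivWithinAt f (∫ τ in (0 : ℝ)..t, h τ) (Ici 0) t := by
  obtain ⟨-, hC, h0, h, hh, hfh⟩ := hf
  refine ⟨by simpa using h0 0 (by norm_num), ?_⟩
  obtain ⟨h', hi, hn, he⟩ := exists_integrable_primitive hh hfh
  refine ⟨h', hi, hn, fun t ht => ?_⟩
  have hd : DifferentiableOn ℝ f (Ici 0) := hC.differentiableOn (by norm_num)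
  have h1 := (hd t ht).hasDerivWithinAt
  rw [← he t ht]
  have h2 : iteratedDerivWithin (2 - 1) f (Ici 0) t = derivWithin f (Ici 0) t := by
    rw [show 2 - 1 = 1 from rfl, iteratedDerivWithin_one]
  rwa [h2]

end DataSpaces

/-! ### Resolvent, lifting, and the problem with homogeneous boundary condition. -/

section Operators

variable {X Y : Type*} [NormedAddCommGroup X] [NormedSpace ℝ X]
  [NormedAddCommGroup Y] [NormedSpace ℝ Y]

/-- A bounded linear functional relation is the graph of a continuous linear map. -/
theorem exists_clm_of_linear_relation {r : X → Y → Prop}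
    (hadd : ∀ x y x' y', r x y → r x' y' → r (x + x') (y + y'))
    (hsmul : ∀ (c : ℝ) x y, r x y → r (c • x) (c • y)) (hex : ∀ x, ∃ y, r x y)
    (huniq : ∀ x y y', r x y → r x y' → y = y') (C : ℝ) (hC : ∀ x y, r x y → ‖y‖ ≤ C * ‖x‖) :
    ∃ T : X →L[ℝ] Y, ∀ x, r x (T x) := by
  choose T hT using hex
  exact ⟨LinearMap.mkContinuous
    { toFun := T
      map_add' := fun x x' => huniq _ _ _ (hT _) (hadd _ _ _ _ (hT x) (hT x'))
      map_smul' := fun c x => huniq _ _ _ (hT _) (hsmul c _ _ (hT x)) } C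
    fun x => hC x _ (hT x), hT⟩

variable {H V M₁ M₂ : Type*}
  [NormedAddCommGroup H] [InnerProductSpace ℝ H]
  [NormedAddCommGroup V] [NormedSpace ℝ V]
  [NormedAddCommGroup M₁] [NormedSpace ℝ M₁] [NormedAddCommGroup M₂] [NormedSpace ℝ M₂]
  {ι A : V →L[ℝ] H} {B : V →L[ℝ] M₂} {G : M₁ →L[ℝ] H}

/-- The resolvent `(1 - A)⁻¹` of the restriction of `A` to `Ker B`. -/
theorem exists_resolvent (hι : Function.Injective ι)
    (hgraph : ∃ C₁ : ℝ, 0 < C₁ ∧ ∀ U : V, C₁ * ‖U‖ ≤ ‖ι U‖ + ‖A U‖)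
    (hdiss : ∀ U : V, B U = 0 → inner ℝ (A U) (ι U) = 0)
    (hmax_sub : ∀ f : H, ∃ U : V, B U = 0 ∧ ι U - A U = f) :
    ∃ R : H →L[ℝ] V, ∀ f, B (R f) = 0 ∧ ι (R f) - A (R f) = f := by
  obtain ⟨C, hC, hCb⟩ := hgraph
  have hle : ∀ U : V, B U = 0 → ‖ι U‖ ≤ ‖ι U - A U‖ := fun U hU => by
    have h1 : inner ℝ (ι U - A U) (ι U) = ‖ι U‖ ^ 2 := by
      rw [inner_sub_left, hdiss U hU, sub_zero, real_inner_self_eq_norm_sq]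
    have h2 := real_inner_le_norm (ι U - A U) (ι U)
    rw [h1] at h2
    by_contra! h3
    nlinarith [norm_nonneg (ι U - A U)]
  -- The 3 comes from `‖ι U‖ ≤ ‖f‖` and `‖A U‖ ≤ ‖ι U‖ + ‖f‖ ≤ 2 ‖f‖`, fed into the graph norm
  -- estimate.
  refine exists_clm_of_linear_relation (r := fun f U => B U = 0 ∧ ι U - A U = f) ?_ ?_ hmax_sub
    ?_ (3 / C) ?_
  · rintro f U f' U' ⟨h1, h2⟩ ⟨h1', h2'⟩
    refine ⟨by rw [map_add, h1, h1', add_zero], ?_⟩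
    rw [← h2, ← h2', map_add, map_add]
    abel
  · rintro c f U ⟨h1, h2⟩
    refine ⟨by rw [map_smul, h1, smul_zero], ?_⟩
    rw [← h2, map_smul, map_smul, smul_sub]
  · rintro f U U' ⟨h1, h2⟩ ⟨h1', h2'⟩
    have h3 := hle (U - U') (by rw [map_sub, h1, h1', sub_zero])
    have h4 : ι (U - U') - A (U - U') = 0 := by
      rw [map_sub, map_sub, sub_sub_sub_comm, h2, h2', sub_self]
    rw [h4, norm_zero, norm_le_zero_iff, map_sub, sub_eq_zero] at h3
    exact hι h3
  · rintro f U ⟨h1, h2⟩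
    have h3 := hle U h1
    rw [h2] at h3
    have h4 : ‖A U‖ ≤ ‖ι U‖ + ‖f‖ := by
      have : A U = ι U - f := by rw [← h2, sub_sub_cancel]
      rw [this]
      exact norm_sub_le _ _
    rw [div_mul_eq_mul_div, le_div_iff₀ hC]
    linarith [hCb U]

theorem exists_lifting
    (hlift : ∀ (x : M₁) (y : M₂), ∃! U : V, ι U = A U + G x ∧ B U = y)
    (hlift_bound : ∃ C : ℝ, ∀ (x : M₁) (y : M₂) (U : V), ι U = A U + G x → B U = y →
      ‖ι U‖ + ‖U‖ ≤ C * ‖(WithLp.toLp 2 (x, y) : WithLp 2 (M₁ × M₂))‖) :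
    ∃ L : WithLp 2 (M₁ × M₂) →L[ℝ] V, ∀ p, ι (L p) = A (L p) + G p.fst ∧ B (L p) = p.snd := by
  obtain ⟨C, hC⟩ := hlift_bound
  refine exists_clm_of_linear_relation
    (r := fun (p : WithLp 2 (M₁ × M₂)) U => ι U = A U + G p.fst ∧ B U = p.snd) ?_ ?_
    (fun p => (hlift p.fst p.snd).exists) (fun p U U' h h' => (hlift _ _).unique h h') C
    fun p U h => ?_
  · rintro p U p' U' ⟨h1, h2⟩ ⟨h1', h2'⟩
    refine ⟨?_, by rw [map_add, h2, h2', WithLp.add_snd]⟩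
    rw [map_add, h1, h1', WithLp.add_fst, map_add, map_add]
    abel
  · rintro c p U ⟨h1, h2⟩
    refine ⟨?_, by rw [map_smul, h2, WithLp.smul_snd]⟩
    rw [map_smul, h1, WithLp.smul_fst, map_smul, map_smul, smul_add]
  · have : ‖ι U‖ + ‖U‖ ≤ C * ‖p‖ := hC _ _ U h.1 h.2
    linarith [norm_nonneg (ι U)]

theorem eq_zero_of_homogeneous (hι : Function.Injective ι)
    (hdiss : ∀ U : V, B U = 0 → inner ℝ (A U) (ι U) = 0) {D : ℝ → V}
    (hderiv : ∀ t, 0 ≤ t → HasDerivWithinAt (fun s => ι (D s)) (A (D t)) (Ici 0) t)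
    (hB : ∀ t, 0 ≤ t → B (D t) = 0) (h0 : D 0 = 0) {t : ℝ} (ht : 0 ≤ t) : D t = 0 := by
  have h := antitoneOn_norm_of_inner_deriv_nonpos hderiv
    (fun t ht => (hdiss _ (hB t ht)).le) ht
  simp only [h0, map_zero, norm_zero, norm_le_zero_iff] at h
  exact hι (by rw [h, map_zero])

/-- The mild solution `w` for the source `h` plays the role of `(ι Z)'`. With `u = ∫ w` and `f = ∫
h`, the equation `w = A Z + f` reads `ι Z - A Z = u - w + f`, which dictates `Z = R (u - w + f)`. -/
theorem exists_homogeneous_boundary_solution [CompleteSpace H] (hι : Function.Injective ι)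
    (hgraph : ∃ C₁ : ℝ, 0 < C₁ ∧ ∀ U : V, C₁ * ‖U‖ ≤ ‖ι U‖ + ‖A U‖)
    (hdiss : ∀ U : V, B U = 0 → inner ℝ (A U) (ι U) = 0)
    (hmax_sub : ∀ f : H, ∃ U : V, B U = 0 ∧ ι U - A U = f)
    {h : ℝ → H} (hloc : LocallyIntegrable h) (hneg : ∀ t ≤ 0, h t = 0) :
    ∃ Z : ℝ → V, Continuous Z ∧ Z 0 = 0 ∧ (∀ t, B (Z t) = 0) ∧
      (∀ t, 0 ≤ t → HasDerivWithinAt (fun s => ι (Z s)) (A (Z t) + ∫ τ in (0 : ℝ)..t, h τ)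
        (Ici 0) t) ∧
      ∃ C, 0 ≤ C ∧ ∀ t, 0 ≤ t → ‖Z t‖ ≤ C * ((t + 2) * ∫ τ in (0 : ℝ)..t, ‖h τ‖) := by
  obtain ⟨R, hR⟩ := exists_resolvent hι hgraph hdiss hmax_sub
  -- With `U = R x` and `x = ι U - A U`, skew-symmetry removes `(ι U, A U)`.
  have hJ : ∀ x, inner ℝ ((ι ∘L R) x) x = ‖(ι ∘L R) x‖ ^ 2 := fun x => by
    simp only [ContinuousLinearMap.comp_apply]
    conv_lhs => rw [← (hR x).2]
    rw [(hR x).2]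
    nth_rewrite 2 [← (hR x).2]
    rw [inner_sub_right, real_inner_comm, real_inner_self_eq_norm_sq,
      real_inner_comm, hdiss _ (hR x).1, sub_zero]
  have hinj : Function.Injective (ι ∘L R) := fun x y hxy => by
    have hR' : R x = R y := hι hxy
    rw [← (hR x).2, ← (hR y).2, hR']
  have hII : ∀ a b, IntervalIntegrable h volume a b := fun a b =>
    (hloc.integrableOn_isCompact isCompact_uIcc).intervalIntegrable
  obtain ⟨w, hwc, hwle, hw0, hw⟩ := exists_mild_solution hJ hinj hloc hneg
  set f : ℝ → H := fun t => ∫ τ in (0 : ℝ)..t, h τ with hf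
  have hfc : Continuous f := intervalIntegral.continuous_primitive hII 0
  set u : ℝ → H := fun t => ∫ s in (0 : ℝ)..t, w s with hu
  have hud : ∀ t, HasDerivAt u (w t) t := fun t => (hwc.integral_hasStrictDerivAt 0 t).hasDerivAt
  have huc : Continuous u := continuous_iff_continuousAt.2 fun t => (hud t).continuousAt
  -- This is the mild equation rearranged: `J w = J f + J u - u`.
  have hιZ : ∀ t, 0 ≤ t → ι (R (u t - w t + f t)) = u t := fun t ht => by
    have h1 : ∫ s in (0 : ℝ)..t, ((ι ∘L R) (w s) - w s) = (ι ∘L R) (u t) - u t := by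
      have h3 : Continuous fun s => (ι ∘L R) (w s) := (ι ∘L R).continuous.comp hwc
      rw [intervalIntegral.integral_sub (h3.intervalIntegrable _ _) (hwc.intervalIntegrable _ _),
        (ι ∘L R).intervalIntegral_comp_comm (hwc.intervalIntegrable _ _)]
    have h2 := hw t ht
    rw [h1] at h2
    change (ι ∘L R) (u t - w t + f t) = u t
    rw [map_add, map_sub, h2]
    abel
  refine ⟨fun t => R (u t - w t + f t), R.continuous.comp ((huc.sub hwc).add hfc), ?_,
    fun t => (hR _).1, fun t ht => ?_, ‖R‖, norm_nonneg _, fun t ht => ?_⟩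
  · simp [hu, hf, hw0]
  · have h1 : A (R (u t - w t + f t)) + f t = w t := by
      have h2 := (hR (u t - w t + f t)).2
      rw [hιZ t ht, sub_eq_iff_eq_add, ← sub_eq_iff_eq_add'] at h2
      rw [← h2]
      abel
    rw [h1]
    exact (hud t).hasDerivWithinAt.congr (fun s hs => hιZ s hs) (hιZ t ht)
  · set N := ∫ τ in (0 : ℝ)..t, ‖h τ‖ with hN
    have hmono : ∀ s ∈ Icc 0 t, ‖w s‖ ≤ N := fun s hs => by
      refine (hwle s hs.1).trans ?_
      exact intervalIntegral.integral_mono_interval le_rfl hs.1 hs.2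
        (Filter.Eventually.of_forall fun _ => norm_nonneg _) (hII 0 t).norm
    have hfN : ‖f t‖ ≤ N := intervalIntegral.norm_integral_le_integral_norm ht
    have huN : ‖u t‖ ≤ N * t := by
      have := intervalIntegral.norm_integral_le_of_norm_le_const (a := 0) (b := t) (f := w)
        (C := N) fun s hs => by
          rw [uIoc_of_le ht] at hs
          exact hmono s (Ioc_subset_Icc_self hs)
      rwa [sub_zero, abs_of_nonneg ht] at this
    refine (R.le_opNorm _).trans (mul_le_mul_of_nonneg_left ?_ (norm_nonneg _))
    calc _ ≤ ‖u t‖ + ‖w t‖ + ‖f t‖ :=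
          (norm_add_le _ _).trans (add_le_add_left (norm_sub_le _ _) _)
      _ ≤ (t + 2) * N := by linarith [hmono t (right_mem_Icc.2 ht)]

end Operators

/-! ### Existence of the classical solution and its growth. -/

section Existence

open Filter Topology

variable {H V M₁ M₂ : Type*}
  [NormedAddCommGroup H] [InnerProductSpace ℝ H] [CompleteSpace H]
  [NormedAddCommGroup V] [NormedSpace ℝ V]
  [NormedAddCommGroup M₁] [NormedSpace ℝ M₁] [CompleteSpace M₁]
  [NormedAddCommGroup M₂] [NormedSpace ℝ M₂] [CompleteSpace M₂]
  {ι A : V →L[ℝ] H} {B : V →L[ℝ] M₂} {G : M₁ →L[ℝ] H}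

/-- The classical solution is the lifting of the boundary data plus the solution of an
equation with homogeneous boundary condition. It grows at most quadratically. -/
theorem exists_classicalSolution (hι : Function.Injective ι)
    (hgraph : ∃ C₁ : ℝ, 0 < C₁ ∧ ∀ U : V, C₁ * ‖U‖ ≤ ‖ι U‖ + ‖A U‖)
    (hdiss : ∀ U : V, B U = 0 → inner ℝ (A U) (ι U) = 0)
    (hmax_sub : ∀ f : H, ∃ U : V, B U = 0 ∧ ι U - A U = f)
    (hlift : ∀ (x : M₁) (y : M₂), ∃! U : V, ι U = A U + G x ∧ B U = y)
    (hlift_bound : ∃ C : ℝ, ∀ (x : M₁) (y : M₂) (U : V), ι U = A U + G x → B U = y →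
      ‖ι U‖ + ‖U‖ ≤ C * ‖(WithLp.toLp 2 (x, y) : WithLp 2 (M₁ × M₂))‖)
    {F : ℝ → H} (hF : MemW 1 F) {ξ : ℝ → M₁} {χ : ℝ → M₂}
    (hΞ : MemW 2 (fun t => (WithLp.toLp 2 (ξ t, χ t) : WithLp 2 (M₁ × M₂)))) :
    ∃ U : ℝ → V, IsClassicalSolution ι A B G ξ χ F U ∧
      ∃ C, ∀ t, 1 ≤ t → ‖U t‖ ≤ C * t ^ (2 : ℝ) := by
  obtain ⟨L, hL⟩ := exists_lifting hlift hlift_bound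
  obtain ⟨hΞzero, h₂, hh₂, hh₂0, hΞd⟩ := hΞ.exists_hasDerivWithinAt
  obtain ⟨h₁, hh₁, hh₁0, hFh⟩ := hF.exists_integral_eq
  set Ξ : ℝ → WithLp 2 (M₁ × M₂) := fun t => WithLp.toLp 2 (ξ t, χ t)
  have hΞ0 : Ξ 0 = 0 := hΞzero
  set p : ℝ → WithLp 2 (M₁ × M₂) := fun t => ∫ τ in (0 : ℝ)..t, h₂ τ with hp
  have hpc : Continuous p :=
    intervalIntegral.continuous_primitive (fun a b => hh₂.intervalIntegrable) 0
  have hΞc : ContinuousOn Ξ (Ici 0) := fun t ht => (hΞd t ht).continuousWithinAt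
  have hΞp : ∀ t, 0 ≤ t → ∫ τ in (0 : ℝ)..t, p τ = Ξ t := fun t ht => by
    rw [intervalIntegral.integral_eq_sub_of_hasDerivAt_of_le ht
      (hΞc.mono Icc_subset_Ici_self)
      (fun s hs => (hΞd s hs.1.le).hasDerivAt (Ici_mem_nhds hs.1))
      (hpc.intervalIntegrable _ _), hΞ0, sub_zero]
  set c₂ := ∫ τ, ‖h₂ τ‖ with hc₂
  have hpb : ∀ t, 0 ≤ t → ‖p t‖ ≤ c₂ := fun t ht => by
    refine (intervalIntegral.norm_integral_le_integral_norm ht).trans ?_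
    rw [intervalIntegral.integral_of_le ht]
    exact setIntegral_le_integral hh₂.norm (Eventually.of_forall fun _ => norm_nonneg _)
  have hΞb : ∀ t, 0 ≤ t → ‖Ξ t‖ ≤ c₂ * t := fun t ht => by
    rw [← hΞp t ht]
    have := intervalIntegral.norm_integral_le_of_norm_le_const (a := 0) (b := t) (f := p)
      (C := c₂) fun s hs => by
        rw [uIoc_of_le ht] at hs
        exact hpb s hs.1.le
    rwa [sub_zero, abs_of_nonneg ht] at this
  set Q : WithLp 2 (M₁ × M₂) →L[ℝ] H := ι ∘L L with hQ
  -- Derivative of the source `F + Q Ξ - Q p` left after subtracting the lifting, where `p = Ξ'`.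
  set h : ℝ → H := fun t => h₁ t + Q (p t) - Q (h₂ t) with hh
  have hQp : Continuous fun t => Q (p t) := Q.continuous.comp hpc
  have hQh : Integrable fun t => Q (h₂ t) := Q.integrable_comp hh₂
  have hloc : LocallyIntegrable h :=
    (hh₁.locallyIntegrable.add hQp.locallyIntegrable).sub hQh.locallyIntegrable
  have hneg : ∀ t ≤ 0, h t = 0 := fun t ht => by
    simp only [hh, hp, hh₁0 t ht, hh₂0 t ht, primitive_eq_zero hh₂0 t ht, map_zero, add_zero,
      sub_zero]
  have hint : ∀ t, 0 ≤ t → ∫ τ in (0 : ℝ)..t, h τ = F t + Q (Ξ t) - Q (p t) := fun t ht => by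
    simp only [hh]
    rw [intervalIntegral.integral_sub
      (hh₁.intervalIntegrable.add (hQp.intervalIntegrable _ _)) hQh.intervalIntegrable,
      intervalIntegral.integral_add hh₁.intervalIntegrable (hQp.intervalIntegrable _ _),
      Q.intervalIntegral_comp_comm (hpc.intervalIntegrable _ _),
      Q.intervalIntegral_comp_comm hh₂.intervalIntegrable, hΞp t ht, ← hFh t ht]
  have hnorm : ∀ t, 0 ≤ t → ∫ τ in (0 : ℝ)..t, ‖h τ‖ ≤
      (∫ τ, ‖h₁ τ‖) + ‖Q‖ * c₂ * t + ‖Q‖ * c₂ := fun t ht => by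
    have hi₁ : IntervalIntegrable (fun τ => ‖h₁ τ‖) volume 0 t := hh₁.norm.intervalIntegrable
    have hi₂ : IntervalIntegrable (fun τ => ‖Q‖ * ‖h₂ τ‖) volume 0 t :=
      (hh₂.norm.const_mul _).intervalIntegrable
    have hle : ∫ τ in (0 : ℝ)..t, ‖h τ‖ ≤
        ∫ τ in (0 : ℝ)..t, (‖h₁ τ‖ + ‖Q‖ * c₂ + ‖Q‖ * ‖h₂ τ‖) := by
      refine intervalIntegral.integral_mono_on ht ?_
        ((hi₁.add intervalIntegrable_const).add hi₂) fun s hs => ?_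
      · exact (hloc.integrableOn_isCompact isCompact_uIcc).intervalIntegrable.norm
      · refine (norm_sub_le _ _).trans (add_le_add ((norm_add_le _ _).trans
          (add_le_add le_rfl ?_)) (Q.le_opNorm _))
        exact (Q.le_opNorm _).trans
          (mul_le_mul_of_nonneg_left (hpb s hs.1) (norm_nonneg _))
    refine hle.trans ?_
    rw [intervalIntegral.integral_add (hi₁.add intervalIntegrable_const) hi₂,
      intervalIntegral.integral_add hi₁ intervalIntegrable_const,
      intervalIntegral.integral_const, intervalIntegral.integral_const_mul, sub_zero,
      smul_eq_mul, mul_comm t, intervalIntegral.integral_of_le ht,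
      intervalIntegral.integral_of_le ht]
    have e₁ := setIntegral_le_integral (s := Ioc 0 t) hh₁.norm
      (Eventually.of_forall fun _ => norm_nonneg _)
    have e₂ := setIntegral_le_integral (s := Ioc 0 t) hh₂.norm
      (Eventually.of_forall fun _ => norm_nonneg _)
    have e₃ := mul_le_mul_of_nonneg_left e₂ (norm_nonneg Q)
    linarith
  obtain ⟨Z, hZc, hZ0, hZB, hZd, C, hC, hZb⟩ :=
    exists_homogeneous_boundary_solution hι hgraph hdiss hmax_sub hloc hneg
  have hUc : ContinuousOn (fun t => L (Ξ t) + Z t) (Ici 0) :=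
    (L.continuous.comp_continuousOn hΞc).add hZc.continuousOn
  have hd : ∀ t, 0 ≤ t → HasDerivWithinAt (fun s => ι (L (Ξ s) + Z s))
      (A (L (Ξ t) + Z t) + G (ξ t) + F t) (Ici 0) t := fun t ht => by
    have e₁ : HasDerivWithinAt (fun s => Q (Ξ s)) (Q (p t)) (Ici 0) t :=
      Q.hasFDerivAt.comp_hasDerivWithinAt t (hΞd t ht)
    have e₂ := e₁.add (hZd t ht)
    have e₃ : (fun s => ι (L (Ξ s) + Z s)) = (fun s => Q (Ξ s)) + fun s => ι (Z s) := by
      ext s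
      simp [hQ]
    rw [e₃]
    refine e₂.congr_deriv ?_
    rw [hint t ht]
    have e₄ : Q (Ξ t) = A (L (Ξ t)) + G (ξ t) := (hL (Ξ t)).1
    rw [e₄, map_add]
    abel
  have hξc : ContinuousOn ξ (Ici 0) :=
    (WithLp.fstL 2 ℝ M₁ M₂).continuous.comp_continuousOn hΞc
  have hFc : ContinuousOn F (Ici 0) :=
    ((intervalIntegral.continuous_primitive
      (fun a b => hh₁.intervalIntegrable) 0).continuousOn).congr fun t ht => hFh t ht
  refine ⟨fun t => L (Ξ t) + Z t, ⟨hUc, ?_, hd, fun t ht => ?_, ?_⟩, ?_⟩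
  · rw [contDiffOn_one_iff_derivWithin (uniqueDiffOn_Ici 0)]
    refine ⟨fun t ht => (hd t ht).differentiableWithinAt, ?_⟩
    refine (((A.continuous.comp_continuousOn hUc).add
      (G.continuous.comp_continuousOn hξc)).add hFc).congr fun t ht => ?_
    exact (hd t ht).derivWithin (uniqueDiffOn_Ici 0 t ht)
  · rw [map_add, hZB, add_zero]
    exact (hL (Ξ t)).2
  · simp only [hΞ0, map_zero, hZ0, add_zero]
  · set a := ∫ τ, ‖h₁ τ‖ with ha
    have ha0 : 0 ≤ a := integral_nonneg fun _ => norm_nonneg _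
    have hc0 : 0 ≤ c₂ := integral_nonneg fun _ => norm_nonneg _
    have hQc : 0 ≤ ‖Q‖ * c₂ := mul_nonneg (norm_nonneg _) hc0
    -- For `t ≥ 1`, the bounds `t ≤ t²`, `t + 2 ≤ 3 t` and `a ≤ a t` absorb all lower powers into
    -- `t²`.
    refine ⟨‖L‖ * c₂ + C * (3 * (a + ‖Q‖ * c₂ + ‖Q‖ * c₂)), fun t ht => ?_⟩
    have ht0 : 0 ≤ t := zero_le_one.trans ht
    have htt : t ≤ t ^ 2 := by nlinarith
    rw [Real.rpow_two]
    have e₁ : ‖L (Ξ t)‖ ≤ ‖L‖ * c₂ * t ^ 2 := by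
      refine (L.le_opNorm _).trans ?_
      rw [mul_assoc]
      refine mul_le_mul_of_nonneg_left ((hΞb t ht0).trans ?_) (norm_nonneg _)
      exact mul_le_mul_of_nonneg_left htt hc0
    have e₂ : (t + 2) * ∫ τ in (0 : ℝ)..t, ‖h τ‖ ≤
        (3 * t) * ((a + ‖Q‖ * c₂ + ‖Q‖ * c₂) * t) := by
      refine mul_le_mul (by linarith) ((hnorm t ht0).trans ?_)
        (intervalIntegral.integral_nonneg ht0 fun _ _ => norm_nonneg _) (by linarith)
      have := mul_le_mul_of_nonneg_left ht ha0
      have := mul_le_mul_of_nonneg_left ht hQc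
      linarith
    have e₃ := (hZb t ht0).trans (mul_le_mul_of_nonneg_left e₂ hC)
    calc _ ≤ ‖L (Ξ t)‖ + ‖Z t‖ := norm_add_le _ _
      _ ≤ _ := add_le_add e₁ e₃
      _ = _ := by ring

end Existence

/-! ### The distributional problem and the two uniqueness statements. -/

section Distributional

variable {H V M₁ M₂ : Type*}
  [NormedAddCommGroup H] [InnerProductSpace ℝ H] [CompleteSpace H]
  [NormedAddCommGroup V] [NormedSpace ℝ V] [CompleteSpace V]
  [NormedAddCommGroup M₁] [NormedSpace ℝ M₁] [CompleteSpace M₁]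
  [NormedAddCommGroup M₂] [NormedSpace ℝ M₂] [CompleteSpace M₂]
  {ι A : V →L[ℝ] H} {B : V →L[ℝ] M₂} {G : M₁ →L[ℝ] H}

theorem clm_extZero {X Y : Type*} [NormedAddCommGroup X] [NormedSpace ℝ X]
    [NormedAddCommGroup Y] [NormedSpace ℝ Y] (L : X →L[ℝ] Y) (f : ℝ → X) :
    (fun t => L (extZero f t)) = extZero fun t => L (f t) := by
  ext t
  simp only [extZero]
  split_ifs <;> simp

theorem IsClassicalSolution.isDistSolution {ξ : ℝ → M₁} {χ : ℝ → M₂} {F : ℝ → H} {U : ℝ → V}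
    (hU : IsClassicalSolution ι A B G ξ χ F U) (hξ : ContinuousOn ξ (Ici 0))
    (hF : ContinuousOn F (Ici 0)) {C m : ℝ} (hm : 0 ≤ m)
    (hgrowth : ∀ t, 1 ≤ t → ‖U t‖ ≤ C * t ^ m) :
    IsDistSolution ι A B G (regDist (extZero ξ)) (regDist (extZero χ)) (regDist (extZero F))
      (regDist (extZero U)) := by
  have hUi := locallyIntegrable_extZero hU.continuousOn
  have hAU : ContinuousOn (fun t => A (U t)) (Ici 0) :=
    A.continuous.comp_continuousOn hU.continuousOn
  have hGξ : ContinuousOn (fun t => G (ξ t)) (Ici 0) := G.continuous.comp_continuousOn hξ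
  have hsum : LocallyIntegrable fun t =>
      extZero (fun t => A (U t)) t + extZero (fun t => G (ξ t)) t :=
    (locallyIntegrable_extZero hAU).add (locallyIntegrable_extZero hGξ)
  refine ⟨⟨extZero U, continuous_extZero hU.continuousOn hU.initial, fun t ht => ?_,
    ⟨C, m, hm, fun t ht => ?_⟩, 0, rfl⟩, ?_, ?_⟩
  · rcases ht.lt_or_eq with ht | rfl
    · exact if_neg ht.not_ge
    · rw [extZero_of_nonneg U le_rfl, hU.initial]
  · rw [extZero_of_nonneg U (zero_le_one.trans ht)]
    exact hgrowth t ht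
  · rw [mapCLM_distDeriv, mapCLM_regDist ι hUi, mapCLM_regDist A hUi,
      mapCLM_regDist G (locallyIntegrable_extZero hξ), clm_extZero, clm_extZero, clm_extZero,
      distDeriv_regDist_extZero ((hAU.add hGξ).add hF) hU.hasDeriv (by simp [hU.initial]),
      ← regDist_add (locallyIntegrable_extZero hAU) (locallyIntegrable_extZero hGξ),
      ← regDist_add hsum (locallyIntegrable_extZero hF)]
    congr 1
    ext t
    simp only [extZero]
    split_ifs <;> simp
  · rw [mapCLM_regDist B hUi, clm_extZero]
    congr 1
    ext t
    simp only [extZero]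
    split_ifs with ht
    · exact hU.boundary t ht
    · rfl

/-- A causal solution of the homogeneous problem which is a derivative of some order of a
continuous function vanishes. -/
theorem distDeriv_iterate_regDist_eq_zero (hι : Function.Injective ι)
    (hdiss : ∀ U : V, B U = 0 → inner ℝ (A U) (ι U) = 0) {g : ℝ → V} (hg : Continuous g)
    (hg0 : ∀ t ≤ 0, g t = 0) {k : ℕ}
    (heq : Distribution.mapCLM ι (distDeriv (distDeriv^[k] (regDist g))) =
      Distribution.mapCLM A (distDeriv^[k] (regDist g)))
    (hB : Distribution.mapCLM B (distDeriv^[k] (regDist g)) = 0) : g = 0 := by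
  have hgi := hg.locallyIntegrable (μ := volume)
  have hBg : Continuous fun t => B (g t) := B.continuous.comp hg
  have hιg : Continuous fun t => ι (g t) := ι.continuous.comp hg
  have hAg : Continuous fun t => A (g t) := A.continuous.comp hg
  have hAg0 : ∀ t ≤ 0, A (g t) = 0 := fun t ht => by rw [hg0 t ht, map_zero]
  -- Causality cancels the `k` derivatives, turning a distributional relation into a pointwise one.
  have hBg0 : (fun t => B (g t)) = 0 := by
    refine eq_zero_of_regDist_eq_zero hBg
      ((isCausal_regDist hBg.locallyIntegrable fun t ht => ?_).eq_zero_of_distDeriv_iterate_eq_zero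
        (k := k) ?_)
    · rw [hg0 t ht.le, map_zero]
    · rw [← mapCLM_regDist B hgi, ← mapCLM_distDeriv_iterate, hB]
  have hpc : Continuous fun t => ∫ s in (0 : ℝ)..t, A (g s) :=
    intervalIntegral.continuous_primitive (fun a b => hAg.intervalIntegrable a b) 0
  have hc : Continuous fun t => ι (g t) - ∫ s in (0 : ℝ)..t, A (g s) := hιg.sub hpc
  -- Here `k + 1` derivatives are cancelled, so the equation survives in integral form; this is what
  -- shows that `ι g` is differentiable.
  have hprim : (fun t => ι (g t) - ∫ s in (0 : ℝ)..t, A (g s)) = 0 := by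
    refine eq_zero_of_regDist_eq_zero hc
      ((isCausal_regDist hc.locallyIntegrable fun t ht => ?_).eq_zero_of_distDeriv_iterate_eq_zero
        (k := k + 1) ?_)
    · rw [hg0 t ht.le, map_zero, primitive_eq_zero hAg0 t ht.le, sub_zero]
    · rw [regDist_sub hιg.locallyIntegrable hpc.locallyIntegrable, distDeriv_iterate_sub,
        Function.iterate_succ_apply, Function.iterate_succ_apply,
        distDeriv_regDist_primitive hAg hAg0, ← mapCLM_regDist ι hgi, ← mapCLM_regDist A hgi,
        ← mapCLM_distDeriv, ← mapCLM_distDeriv_iterate, ← mapCLM_distDeriv_iterate,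
        ← Function.iterate_succ_apply, Function.iterate_succ_apply', heq, sub_self]
  ext t
  rcases le_total t 0 with ht | ht
  · exact hg0 t ht
  · refine eq_zero_of_homogeneous hι hdiss (fun s _ => ?_) (fun s _ => congrFun hBg0 s)
      (hg0 0 le_rfl) ht
    have h1 : (fun t => ι (g t)) = fun t => ∫ s in (0 : ℝ)..t, A (g s) :=
      funext fun t => sub_eq_zero.1 (congrFun hprim t)
    rw [h1]
    exact (hAg.integral_hasStrictDerivAt 0 s).hasDerivAt.hasDerivWithinAt

omit [CompleteSpace M₁] in
theorem IsDistSolution.unique (hι : Function.Injective ι)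
    (hdiss : ∀ U : V, B U = 0 → inner ℝ (A U) (ι U) = 0)
    {ξ : 𝓓'((⊤ : TopologicalSpace.Opens ℝ), M₁)} {χ : 𝓓'((⊤ : TopologicalSpace.Opens ℝ), M₂)}
    {F : 𝓓'((⊤ : TopologicalSpace.Opens ℝ), H)} {S T : 𝓓'((⊤ : TopologicalSpace.Opens ℝ), V)}
    (hS : IsDistSolution ι A B G ξ χ F S) (hT : IsDistSolution ι A B G ξ χ F T) : S = T := by
  obtain ⟨g, hg, hg0, -, k, hSg⟩ := hS.isTD
  obtain ⟨f, hf, hf0, -, l, hTf⟩ := hT.isTD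
  -- Each representative is integrated as often as the other is differentiated, giving the common
  -- order `k + l`.
  obtain ⟨g', hg', hg0', hgg⟩ := exists_primitive_iterate l hg hg0
  obtain ⟨f', hf', hf0', hff⟩ := exists_primitive_iterate k hf hf0
  have hd : S - T = distDeriv^[k + l] (regDist fun t => g' t - f' t) := by
    rw [regDist_sub hg'.locallyIntegrable hf'.locallyIntegrable, distDeriv_iterate_sub,
      Function.iterate_add_apply, hgg, ← hSg, add_comm, Function.iterate_add_apply, hff, ← hTf]
  have h0 : (fun t => g' t - f' t) = 0 := by
    refine distDeriv_iterate_regDist_eq_zero hι hdiss (hg'.sub hf') (k := k + l)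
      (fun t ht => by rw [hg0' t ht, hf0' t ht, sub_zero]) ?_ ?_
    · rw [← hd, distDeriv_sub, map_sub, map_sub, hS.equation, hT.equation]
      abel
    · rw [← hd, map_sub, hS.boundary, hT.boundary, sub_self]
  have hz : regDist (fun t => g' t - f' t) = 0 := by
    rw [regDist_sub hg'.locallyIntegrable hf'.locallyIntegrable]
    have h1 : g' = f' := funext fun t => sub_eq_zero.1 (congrFun h0 t)
    rw [h1, sub_self]
  rw [hz] at hd
  have h2 : distDeriv^[k + l] (0 : 𝓓'((⊤ : TopologicalSpace.Opens ℝ), V)) = 0 := by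
    have := distDeriv_iterate_sub (k + l) (0 : 𝓓'((⊤ : TopologicalSpace.Opens ℝ), V)) 0
    rwa [sub_self, sub_self] at this
  rw [h2] at hd
  exact sub_eq_zero.1 hd

omit [CompleteSpace H] [CompleteSpace V] [CompleteSpace M₁] [CompleteSpace M₂] in
theorem IsClassicalSolution.eqOn (hι : Function.Injective ι)
    (hdiss : ∀ U : V, B U = 0 → inner ℝ (A U) (ι U) = 0)
    {ξ : ℝ → M₁} {χ : ℝ → M₂} {F : ℝ → H} {U U' : ℝ → V}
    (hU : IsClassicalSolution ι A B G ξ χ F U) (hU' : IsClassicalSolution ι A B G ξ χ F U') :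
    EqOn U U' (Ici 0) := fun t ht => by
  have h := eq_zero_of_homogeneous (D := fun t => U t - U' t) hι hdiss (fun s hs => ?_)
    (fun s hs => by rw [map_sub, hU.boundary s hs, hU'.boundary s hs, sub_self])
    (by rw [hU.initial, hU'.initial, sub_self]) ht
  · exact sub_eq_zero.1 h
  · have h1 := (hU.hasDeriv s hs).sub (hU'.hasDeriv s hs)
    have h2 : (fun s => ι (U s - U' s)) = (fun s => ι (U s)) - fun s => ι (U' s) := by
      ext s
      simp
    rw [h2]
    refine h1.congr_deriv ?_
    rw [map_sub]
    abel

end Distributional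

end DistExt

theorem theorem3p2
    {H V M₁ M₂ : Type*}
    [NormedAddCommGroup H] [InnerProductSpace ℝ H] [CompleteSpace H]
    [NormedAddCommGroup V] [InnerProductSpace ℝ V] [CompleteSpace V]
    [NormedAddCommGroup M₁] [InnerProductSpace ℝ M₁] [CompleteSpace M₁]
    [NormedAddCommGroup M₂] [InnerProductSpace ℝ M₂] [CompleteSpace M₂]
    -- `V` is continuously embedded in `H`
    (ι : V →L[ℝ] H) (hι : Function.Injective ι)
    (A : V →L[ℝ] H)
    (B : V →L[ℝ] M₂) (hB : Function.Surjective B)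
    (G : M₁ →L[ℝ] H)
    -- the graph norm of `A` controls the norm of `V`
    (hgraph : ∃ C₁ : ℝ, 0 < C₁ ∧ ∀ U : V, C₁ * ‖U‖ ≤ ‖ι U‖ + ‖A U‖)
    -- `± A`, with domain `Ker B`, are maximal dissipative
    (hdiss : ∀ U : V, B U = 0 → inner ℝ (A U) (ι U) = 0)
    (hmax_add : ∀ f : H, ∃ U : V, B U = 0 ∧ ι U + A U = f)
    (hmax_sub : ∀ f : H, ∃ U : V, B U = 0 ∧ ι U - A U = f)
    -- the lifting operator is well defined and bounded
    (hlift : ∀ (x : M₁) (y : M₂), ∃! U : V, ι U = A U + G x ∧ B U = y)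
    (hlift_bound : ∃ C : ℝ, ∀ (x : M₁) (y : M₂) (U : V), ι U = A U + G x → B U = y →
      ‖ι U‖ + ‖U‖ ≤ C * ‖(WithLp.toLp 2 (x, y) : WithLp 2 (M₁ × M₂))‖)
    -- the data
    (F : ℝ → H) (hF : DistExt.MemW 1 F)
    (ξ : ℝ → M₁) (χ : ℝ → M₂)
    (hΞ : DistExt.MemW 2 (fun t => (WithLp.toLp 2 (ξ t, χ t) : WithLp 2 (M₁ × M₂)))) :
    ∃ U : ℝ → V,
      DistExt.IsClassicalSolution ι A B G ξ χ F U ∧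
      (∀ U' : ℝ → V, DistExt.IsClassicalSolution ι A B G ξ χ F U' →
        Set.EqOn U' U (Set.Ici 0)) ∧
      DistExt.IsDistSolution ι A B G
        (DistExt.regDist (DistExt.extZero ξ)) (DistExt.regDist (DistExt.extZero χ))
        (DistExt.regDist (DistExt.extZero F)) (DistExt.regDist (DistExt.extZero U)) ∧
      ∀ T, DistExt.IsDistSolution ι A B G
        (DistExt.regDist (DistExt.extZero ξ)) (DistExt.regDist (DistExt.extZero χ))
        (DistExt.regDist (DistExt.extZero F)) T →
        T = DistExt.regDist (DistExt.extZero U) := by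
  obtain ⟨U, hU, C, hC⟩ := DistExt.exists_classicalSolution hι hgraph hdiss hmax_sub hlift
    hlift_bound hF hΞ
  have hΞc : ContinuousOn (fun t => (WithLp.toLp 2 (ξ t, χ t) : WithLp 2 (M₁ × M₂)))
      (Set.Ici 0) := hΞ.2.1.continuousOn
  have hsol := hU.isDistSolution ((WithLp.fstL 2 ℝ M₁ M₂).continuous.comp_continuousOn hΞc)
    hF.2.1.continuousOn zero_le_two hC
  exact ⟨U, hU, fun U' hU' => hU'.eqOn hι hdiss hU, hsol, fun T hT => hT.unique hι hdiss hsol⟩
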